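/- **Setting.** A quantum channel $\mathcal{E}$ on a $d$-dimensional system is a map $\rho\mapsto\sum_i E_i\rho E_i^\dagger$ with $\sum_i E_i^\dagger E_i\le I$ (it need not preserve the trace). Its orthogonality- and purity-preservation indices are $$\mathfrak{o}(\mathcal{E})=\mathbb{E}_U\big[\operatorname{tr}\big(\mathcal{E}(|\phi\rangle\langle\phi|)\,\mathcal{E}(|\psi\rangle\langle\psi|)\big)\big]\quad(d\ge 2),\qquad \mathfrak{p}(\mathcal{E})=\mathbb{E}_U\big[\operatorname{tr}\big(\mathcal{E}(|\psi\rangle\langle\psi|)^2\big)\big]\quad(d\ge1),$$ where $U$ is a Haar random $d\times d$ unitary, $|\psi\rangle=U|0\rangle$, $|\phi\rangle=U|1\rangle$. Its unitarity is $\mathfrak{u}(\mathcal{E})=\operatorname{tr}(\mathfrak{J}(\mathcal{E})^2)$ with $\mathfrak{J}(\mathcal{E})=(\mathcal{E}\otimes\mathcal{I})(|\Phi\rangle\langle\Phi|)$ and $|\Phi\rangle=d^{-1/2}\sum_i|i\rangle|i\rangle$. A *non-adaptive ancilla-free incoherent algorithm* draws a classical random seed; in each of finitely many rounds it prepares a state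 on $\mathbb{C}^d$, applies $\mathcal{E}$ once and measures the result with a finite-outcome POVM on $\mathbb{C}^d$, where the state and the POVM of each round depend only on the seed; finally it computes a real number from the seed and the outcomes. If the output state is $\tau$, then the failure outcome $\bot$ occurs with probability $1-\operatorname{tr}\tau$. The number of calls is the number of rounds. *Subroutine (inner-product estimation with parameters $N,m$).* Input: $2Nm$ copies of each of two subnormalized states $\rho,\sigma$ on $\mathbb{C}^d$. For $j=1,\dots,N$ draw a Haar random unitary $V_j$, measure $m$ copies of $\rho$ and $m$ copies of $\sigma$ in the basis $\{V_j^\dagger|b\rangle\}_{b=0}^{d-1}$, obtaining $x_1,\dots,x_m$ and $y_1,\dots,y_m$, and let $\tilde g_j=\frac1{m^2}\sum_{k,l=1}^m 1[x_k=y_l\ne\bot]$. Measure the remaining $Nm$ copies of $\rho$ and of $\sigma$ with the trivial POVM $\{I\}$, and let $t_1,t_2$ be the fractions of non-failures. Return $\frac1N\sum_{j=1}^N(d+1)\tilde g_j-t_1t_2$. *Algorithm for $\mathfrak{o}$ with parameters $M,N,m$.* For $i=1,\dots,M$ draw a Haar random unitary $U_i$ and run the subroutine on $\rho_i=\mathcal{E}(U_i|0\rangle\langle0|U_i^\dagger)$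 and $\sigma_i=\mathcal{E}(U_i|1\rangle\langle1|U_i^\dagger)$ to obtain $z_i$. Return $z=\frac1M\sum_{i=1}^M z_i$. All random choices are independent. The *algorithm for $\mathfrak{p}$* is the same, with both inputs equal to $U_i|0\rangle\langle0|U_i^\dagger$. **Theorem.** 1. For every $c>0$ there is $c'>0$ such that for every $K$ there is $C$ with the following property. Let $d\ge2$, $\epsilon>0$, and let $M,N,m$ be natural numbers with $c'\epsilon^{-2}\le M\le K\epsilon^{-2}$, $1\le N\le K$ and $c\sqrt d\le m\le K\sqrt d$ (that is, $M=\Theta(\epsilon^{-2})$, $N=\Theta(1)$, $m=\Theta(\sqrt d)$). Then the algorithm for $\mathfrak{o}$, which is non-adaptive and ancilla-free, makes at most $C\sqrt d\,\epsilon^{-2}$ calls to $\mathcal{E}$, and for every channel $\mathcal{E}$ on a $d$-dimensional system its output $z$ satisfies $|z-\mathfrak{o}(\mathcal{E})|<\epsilon$ with probability at least $2/3$. 2. The same holds for the algorithm for $\mathfrak{p}$ and $\mathfrak{p}(\mathcal{E})$, for all $d\ge1$. 3. There is a constant $C$ such that for all $d\ge1$ and $\epsilon>0$ there is a non-adaptive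 ancilla-free incoherent algorithm making at most $C\sqrt d\,\epsilon^{-2}$ calls whose output $z$ satisfies, for every channel $\mathcal{E}$ on a $d$-dimensional system, $|z-\mathfrak{u}(\mathcal{E})|<\epsilon$ with probability at least $2/3$. -/

import Mathlib

open MeasureTheory
open scoped Matrix ComplexOrder

/-- A quantum channel on a `d`-dimensional system, not necessarily trace-preserving:
`ρ ↦ ∑ i, K i * ρ * (K i)ᴴ` with `∑ i, (K i)ᴴ * K i ≤ 1`. -/
structure QuantumChannel (d : ℕ) where
  toLin : Matrix (Fin d) (Fin d) ℂ →ₗ[ℂ] Matrix (Fin d) (Fin d) ℂ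
  exists_kraus : ∃ (r : ℕ) (K : Fin r → Matrix (Fin d) (Fin d) ℂ),
    (1 - ∑ i, (K i)ᴴ * K i).PosSemidef ∧ ∀ ρ, toLin ρ = ∑ i, K i * ρ * (K i)ᴴ

/-- A density matrix. -/
def IsDensityMatrix {d : ℕ} (ρ : Matrix (Fin d) (Fin d) ℂ) : Prop :=
  ρ.PosSemidef ∧ ρ.trace = 1

/-- A POVM with finitely many outcomes. -/
def IsPOVM {d : ℕ} {X : Type} [Fintype X] (F : X → Matrix (Fin d) (Fin d) ℂ) : Prop :=
  (∀ x, (F x).PosSemidef) ∧ ∑ x, F x = 1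

/-- The matrix `|v⟩⟨v|`. -/
def ketBra {n : Type} (v : n → ℂ) : Matrix n n ℂ :=
  Matrix.vecMulVec v (star v)

/-! ### Haar measure on the unitary group -/

/-- The group of `d × d` unitary matrices. -/
abbrev UnitaryMat (d : ℕ) : Type := Matrix.unitaryGroup (Fin d) ℂ

instance UnitaryMat.compactSpace (d : ℕ) : CompactSpace (UnitaryMat d) := by
  have hset : IsCompact
      (Set.pi Set.univ fun _ : Fin d => Set.pi Set.univ fun _ : Fin d =>
        Metric.closedBall (0 : ℂ) 1) :=
    isCompact_univ_pi fun _ => isCompact_univ_pi fun _ => isCompact_closedBall _ _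
  have hclosed : IsClosed
      ((Matrix.unitaryGroup (Fin d) ℂ : Set (Matrix (Fin d) (Fin d) ℂ))) :=
    isClosed_unitary
  refine isCompact_iff_compactSpace.mp (IsCompact.of_isClosed_subset hset hclosed ?_)
  intro U hU i _ j _
  simpa using entry_norm_bound_of_unitary hU i j

noncomputable instance UnitaryMat.measurableSpace (d : ℕ) : MeasurableSpace (UnitaryMat d) := borel _

instance UnitaryMat.borelSpace (d : ℕ) : BorelSpace (UnitaryMat d) := ⟨rfl⟩

/-- The Haar measure on the unitary group, of total mass `1`. -/
noncomputable def haarUnitary (d : ℕ) : Measure (UnitaryMat d) :=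
  Measure.haarMeasure ⊤

instance haarUnitary_isProbabilityMeasure (d : ℕ) : IsProbabilityMeasure (haarUnitary d) :=
  ⟨Measure.haarMeasure_self (K₀ := (⊤ : TopologicalSpace.PositiveCompacts (UnitaryMat d)))⟩

/-! ### Indices of a channel -/

/-- The pure state `U|a⟩⟨a|Uᴴ`. -/
noncomputable def rotatedState {d : ℕ} (U : UnitaryMat d) (a : Fin d) :
    Matrix (Fin d) (Fin d) ℂ :=
  ketBra ((U : Matrix (Fin d) (Fin d) ℂ) *ᵥ Pi.single a 1)

/-- The purity-preservation index: `𝔼 tr(E(|ψ⟩⟨ψ|)²)` for `ψ = U|0⟩` with `U` Haar random. -/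
noncomputable def purityIndex {d : ℕ} [NeZero d] (E : QuantumChannel d) : ℝ :=
  ∫ U, (E.toLin (rotatedState U 0) * E.toLin (rotatedState U 0)).trace.re ∂haarUnitary d

/-- The orthogonality-preservation index: `𝔼 tr(E(|φ⟩⟨φ|) E(|ψ⟩⟨ψ|))` for
`(ψ, φ) = (U|0⟩, U|1⟩)` with `U` Haar random (meaningful for `2 ≤ d`). -/
noncomputable def orthogonalityIndex {d : ℕ} [NeZero d] (E : QuantumChannel d) : ℝ :=
  ∫ U, (E.toLin (rotatedState U 1) * E.toLin (rotatedState U 0)).trace.re ∂haarUnitary d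

/-- The maximally entangled vector `d^{-1/2} ∑ i, |i⟩|i⟩`. -/
noncomputable def maxEntangled (d : ℕ) : Fin d × Fin d → ℂ :=
  fun x => if x.1 = x.2 then (((Real.sqrt d)⁻¹ : ℝ) : ℂ) else 0

/-- `(E ⊗ id)(X)`: the channel acts on the first tensor factor. -/
def applyFirst {d : ℕ} (E : QuantumChannel d) (X : Matrix (Fin d × Fin d) (Fin d × Fin d) ℂ) :
    Matrix (Fin d × Fin d) (Fin d × Fin d) ℂ :=
  Matrix.of fun x y => E.toLin (Matrix.of fun a b => X (a, x.2) (b, y.2)) x.1 y.1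

/-- The Jamiołkowski state of a channel. -/
noncomputable def jamiolkowski {d : ℕ} (E : QuantumChannel d) :
    Matrix (Fin d × Fin d) (Fin d × Fin d) ℂ :=
  applyFirst E (ketBra (maxEntangled d))

/-- The unitarity of a channel: the purity of its Jamiołkowski state. -/
noncomputable def unitarity {d : ℕ} (E : QuantumChannel d) : ℝ :=
  (jamiolkowski E * jamiolkowski E).trace.re

/-! ### Algorithms with non-adaptive, ancilla-free incoherent access -/

/-- An algorithm with incoherent access to an unknown channel on a `d`-dimensional system that is
non-adaptive and uses no ancilla. A classical random seed is drawn first. In each round, a state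
of the `d`-dimensional system is prepared, the channel is applied to it once, and the result is
measured by a POVM on the `d`-dimensional system; state and POVM depend on the round and the seed
only, never on measurement outcomes. Finally a real number is computed from the seed and the
outcomes. The outcome `none` is the failure that occurs when the channel loses trace. -/
structure IncoherentAlgorithm (d : ℕ) where
  Seed : Type
  [seedSpace : MeasurableSpace Seed]
  seedLaw : Measure Seed
  [seedProb : IsProbabilityMeasure seedLaw]
  Round : Type
  [roundFintype : Fintype Round]
  [roundDecEq : DecidableEq Round]
  Outcome : Type
  [outcomeFintype : Fintype Outcome]
  state : Round → Seed → Matrix (Fin d) (Fin d) ℂ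
  povm : Round → Seed → Outcome → Matrix (Fin d) (Fin d) ℂ
  estimate : Seed → (Round → Option Outcome) → ℝ
  state_isDensityMatrix : ∀ t s, IsDensityMatrix (state t s)
  povm_isPOVM : ∀ t s, IsPOVM (povm t s)
  measurable_state : ∀ t i j, Measurable fun s => state t s i j
  measurable_povm : ∀ t x i j, Measurable fun s => povm t s x i j
  measurable_estimate : ∀ o, Measurable fun s => estimate s o

namespace IncoherentAlgorithm

attribute [instance] seedSpace seedProb roundFintype roundDecEq outcomeFintype

variable {d : ℕ}

/-- The number of calls to the channel: one in each round. -/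
def calls (A : IncoherentAlgorithm d) : ℕ := Fintype.card A.Round

/-- The conditional probability of an outcome of round `t` given the seed `s`, when the unknown
channel is `E`. -/
noncomputable def outcomeProb (A : IncoherentAlgorithm d) (E : QuantumChannel d) (t : A.Round)
    (s : A.Seed) : Option A.Outcome → ℝ
  | none => 1 - (E.toLin (A.state t s)).trace.re
  | some x => (A.povm t s x * E.toLin (A.state t s)).trace.re

/-- The probability that the estimate lies in `S`, when the unknown channel is `E`: given the
seed, the outcomes of the rounds are independent. -/
noncomputable def probEstimateMem (A : IncoherentAlgorithm d) (E : QuantumChannel d)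
    (S : Set ℝ) : ℝ :=
  ∫ s, ∑ o : A.Round → Option A.Outcome,
    {o | A.estimate s o ∈ S}.indicator (fun o => ∏ t, A.outcomeProb E t s (o t)) o ∂A.seedLaw

end IncoherentAlgorithm

/-! ### The inner-product estimator for subnormalized states -/

/-- The partial collision estimator `m⁻² ∑ j k, 1[x j = y k ≠ ⊥]`. -/
noncomputable def collisionEstimator {d m : ℕ} (x y : Fin m → Option (Fin d)) : ℝ :=
  ((m : ℝ) ^ 2)⁻¹ * ∑ j, ∑ k, if x j = y k ∧ x j ≠ none then 1 else 0

/-- The fraction of the samples that are not failures. -/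
noncomputable def validFraction {d n : ℕ} (x : Fin n → Option (Fin d)) : ℝ :=
  (n : ℝ)⁻¹ * ∑ j, if x j ≠ none then 1 else 0

/-- The measurements made on the copies of one state: `m` copies are measured in each of `N`
random bases, and `N * m` further copies by the trivial POVM. -/
abbrev CopyIndex (N m : ℕ) : Type := (Fin N × Fin m) ⊕ Fin (N * m)

/-- The classical post-processing of the distributed inner-product estimator, from the outcomes
`x` on the copies of `ρ` and `y` on those of `σ`: `N⁻¹ ∑ i, (d + 1) * g̃ i - t₁ * t₂`. -/
noncomputable def innerProductEstimate {d N m : ℕ} (x y : CopyIndex N m → Option (Fin d)) : ℝ :=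
  (N : ℝ)⁻¹ * ∑ i : Fin N, ((d : ℝ) + 1) *
      collisionEstimator (fun k => x (Sum.inl (i, k))) (fun k => y (Sum.inl (i, k)))
    - validFraction (fun j => x (Sum.inr j)) * validFraction (fun j => y (Sum.inr j))

/-- The measurement in the basis `{Vᴴ|b⟩⟨b|V}`. -/
def basisPOVM {d : ℕ} (V : UnitaryMat d) (b : Fin d) : Matrix (Fin d) (Fin d) ℂ :=
  (V : Matrix (Fin d) (Fin d) ℂ)ᴴ * Matrix.single b b 1 * (V : Matrix (Fin d) (Fin d) ℂ)

/-- The trivial POVM `{I}`; its only possible outcome, apart from failure, is labelled `0`. -/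
def trivialPOVM {d : ℕ} [NeZero d] (b : Fin d) : Matrix (Fin d) (Fin d) ℂ :=
  if b = 0 then 1 else 0

/-- The POVM applied to a copy, where `V i` is the `i`-th random basis. -/
def copyPOVM {d N m : ℕ} [NeZero d] (V : Fin N → UnitaryMat d) :
    CopyIndex N m → Fin d → Matrix (Fin d) (Fin d) ℂ
  | Sum.inl (i, _) => basisPOVM (V i)
  | Sum.inr _ => trivialPOVM

theorem rotatedState_isDensityMatrix {d : ℕ} (U : UnitaryMat d) (a : Fin d) :
    IsDensityMatrix (rotatedState U a) := by
  refine ⟨Matrix.posSemidef_vecMulVec_self_star _, ?_⟩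
  have h : (U : Matrix (Fin d) (Fin d) ℂ)ᴴ * (U : Matrix (Fin d) (Fin d) ℂ) = 1 :=
    Matrix.UnitaryGroup.star_mul_self U
  have h2 := congrFun (congrFun h a) a
  simp only [Matrix.mul_apply, Matrix.conjTranspose_apply, Matrix.one_apply_eq] at h2
  rw [rotatedState, ketBra, Matrix.trace_vecMulVec]
  refine Eq.trans ?_ h2
  refine Finset.sum_congr rfl fun i _ => ?_
  simp [mul_comm]

theorem basisPOVM_isPOVM {d : ℕ} (V : UnitaryMat d) : IsPOVM (basisPOVM V) := by
  refine ⟨fun b => ?_, ?_⟩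
  · have h : (Matrix.single b b (1 : ℂ)).PosSemidef := by
      have := Matrix.PosSemidef.diagonal (n := Fin d) (R := ℂ) (d := Pi.single b 1) (by
        intro i; by_cases hi : i = b
        · subst hi; simp
        · simp [hi])
      rwa [Matrix.diagonal_single] at this
    exact h.conjTranspose_mul_mul_same _
  · have h : (V : Matrix (Fin d) (Fin d) ℂ)ᴴ * (V : Matrix (Fin d) (Fin d) ℂ) = 1 :=
      Matrix.UnitaryGroup.star_mul_self V
    have h1 : ∑ b : Fin d, Matrix.single b b (1 : ℂ) = 1 := by
      ext i j
      simp only [Matrix.sum_apply, Matrix.single_apply, Matrix.one_apply]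
      by_cases hij : i = j
      · subst hij; simp
      · rw [if_neg hij]
        exact Finset.sum_eq_zero fun b _ => if_neg fun h => hij (h.1.symm.trans h.2)
    simp only [basisPOVM]
    rw [← Finset.sum_mul, ← Finset.mul_sum, h1, mul_one, h]

theorem trivialPOVM_isPOVM {d : ℕ} [NeZero d] : IsPOVM (trivialPOVM (d := d)) := by
  refine ⟨fun b => ?_, ?_⟩
  · unfold trivialPOVM
    split_ifs
    · exact Matrix.PosSemidef.one
    · exact Matrix.PosSemidef.zero
  · simp [trivialPOVM]

theorem copyPOVM_isPOVM {d N m : ℕ} [NeZero d] (V : Fin N → UnitaryMat d) (c : CopyIndex N m) :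
    IsPOVM (copyPOVM V c) := by
  rcases c with ⟨i, k⟩ | j
  · exact basisPOVM_isPOVM (V i)
  · exact trivialPOVM_isPOVM

theorem measurable_rotatedState {d : ℕ} (a i j : Fin d) :
    Measurable fun U : UnitaryMat d => rotatedState U a i j := by
  apply Continuous.measurable
  unfold rotatedState ketBra
  simp only [Matrix.vecMulVec_apply, Pi.star_apply]
  fun_prop

theorem measurable_copyPOVM {d N m : ℕ} [NeZero d] (c : CopyIndex N m) (b i j : Fin d) :
    Measurable fun V : Fin N → UnitaryMat d => copyPOVM V c b i j := by
  rcases c with ⟨l, k⟩ | l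
  · have h : Measurable fun V : UnitaryMat d => basisPOVM V b i j := by
      apply Continuous.measurable
      unfold basisPOVM
      fun_prop
    exact h.comp (measurable_pi_apply l)
  · exact measurable_const

/-- The estimation algorithm with `M` input settings and parameters `N`, `m`. For each `i`, a Haar
random unitary `U i` is drawn, and the inner product of `ρ i = E(U i|a⟩⟨a|(U i)ᴴ)` and
`σ i = E(U i|b⟩⟨b|(U i)ᴴ)` is estimated by the distributed inner-product estimator from
`2 * N * m` copies of each, with `N` Haar random bases; the average of the estimates is returned.
A round is a triple `(i, side, c)`, the call that produces and measures copy `c` of `ρ i`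
(if `side = false`) or of `σ i` (if `side = true`). -/
noncomputable def pairEstimator (d : ℕ) [NeZero d] (a b : Fin d) (M N m : ℕ) :
    IncoherentAlgorithm d where
  Seed := Fin M → UnitaryMat d × (Fin N → UnitaryMat d)
  seedLaw := Measure.pi fun _ => (haarUnitary d).prod (Measure.pi fun _ => haarUnitary d)
  Round := Fin M × Bool × CopyIndex N m
  Outcome := Fin d
  state := fun t s => rotatedState (s t.1).1 (if t.2.1 then b else a)
  povm := fun t s => copyPOVM (s t.1).2 t.2.2
  estimate := fun _ o => (M : ℝ)⁻¹ * ∑ i : Fin M,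
    innerProductEstimate (fun c => o (i, false, c)) (fun c => o (i, true, c))
  state_isDensityMatrix := fun _ _ => rotatedState_isDensityMatrix _ _
  povm_isPOVM := fun _ _ => copyPOVM_isPOVM _ _
  measurable_state := fun t i j =>
    (measurable_rotatedState _ i j).comp (measurable_fst.comp (measurable_pi_apply t.1))
  measurable_povm := fun t x i j =>
    (measurable_copyPOVM _ x i j).comp (measurable_snd.comp (measurable_pi_apply t.1))
  measurable_estimate := fun _ => measurable_const

/-- The algorithm for the orthogonality-preservation index: input states `U|0⟩` and `U|1⟩`. -/
noncomputable def orthogonalityEstimator (d : ℕ) [NeZero d] (M N m : ℕ) : IncoherentAlgorithm d :=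
  pairEstimator d 0 1 M N m

/-- The algorithm for the purity-preservation index: both input states are `U|0⟩`. -/
noncomputable def purityEstimator (d : ℕ) [NeZero d] (M N m : ℕ) : IncoherentAlgorithm d :=
  pairEstimator d 0 0 M N m

/-! ### Invariance of the Haar measure on the unitary group -/

/-! Each of the `M` blocks yields an independent sample whose mean is exactly the index and whose
second moment is bounded by a constant not depending on `d`. Chebyshev's inequality for the mean of
`M = Θ(ε⁻²)` samples then gives error below `ε` with probability at least `2/3`. So the proof
consists of one mean and one second moment, both for a single block.

Mean. Conditionally on the basis, with outcome laws `p` and `q` for the two states, the collision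
estimator has mean `∑ b, p b * q b`. Averaged over a Haar random basis this is `(tr ρ tr σ + tr ρσ)
/ (d + 1)`, so multiplying by `d + 1` and subtracting the independent estimate `t₁ t₂` of `tr ρ tr
σ` leaves `tr ρσ` (`integral_productExp_innerProductEstimate`).

Second moment. The collision estimator is `m⁻² ∑ b, n b * n' b` in terms of the outcome counts, so
its conditional second moment involves `p` and `q` only through products of total degree two to
four. Elementary inequalities reduce it to `∑ p q / m²` and `d ∑ (p⁴ + q⁴)`
(`sum_collision_moments_le`). The Haar average of `p b ^ 4` is `O(d⁻⁴)`, so after the factor `(d +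
1)²` the second moment is `O(d / m² + 1)`, bounded as soon as `m ≥ c √d`. Larger `N` is not needed.

Haar moments. Only invariance is used. A phase on one coordinate of a random column kills the
unbalanced moments, and averaging the invariance under rotations by a `3-4-5` angle gives linear
relations or inequalities between the moments of two coordinates. Together with normalization these
give the second moments exactly and a fourth-moment bound of the right order.

Unitarity. Expanding the Jamiołkowski state shows `𝔲 = (1 + 1/d) 𝔭 - tr E(I/d)²` (`unitarity_eq`),
so the same block estimator, run on a Haar random pure state and on the maximally mixed state,
applies. -/

instance haarUnitary_isHaarMeasure (d : ℕ) : (haarUnitary d).IsHaarMeasure := by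
  unfold haarUnitary; infer_instance

instance haarUnitary_isMulRightInvariant (d : ℕ) : (haarUnitary d).IsMulRightInvariant := by
  refine ⟨fun g => ?_⟩
  have : IsProbabilityMeasure (Measure.map (· * g) (haarUnitary d)) :=
    Measure.isProbabilityMeasure_map (by fun_prop)
  exact Measure.isHaarMeasure_eq_of_isProbabilityMeasure _ _

/-- Right invariance makes the inverted measure left invariant, hence a multiple of Haar measure,
and the total mass fixes the multiple. This is needed because the measured vectors `Vᴴ|b⟩` are
columns of `V⁻¹`, not of `V`. -/
instance haarUnitary_isInvInvariant (d : ℕ) : (haarUnitary d).IsInvInvariant := by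
  refine ⟨?_⟩
  have : IsProbabilityMeasure (haarUnitary d).inv :=
    Measure.isProbabilityMeasure_map (by fun_prop)
  have h := Measure.isMulInvariant_eq_smul_of_compactSpace (haarUnitary d).inv (haarUnitary d)
  have h1 := congrArg (fun μ : Measure (UnitaryMat d) => μ Set.univ) h
  simp only [measure_univ, Measure.smul_apply, ENNReal.smul_def, smul_eq_mul, mul_one] at h1
  rw [h]
  ext s _
  rw [Measure.smul_apply, ENNReal.smul_def, ← h1, smul_eq_mul, one_mul]

theorem integrable_haarUnitary_of_continuous {d : ℕ} {F : Type*} [NormedAddCommGroup F]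
    {f : UnitaryMat d → F} (hf : Continuous f) : Integrable f (haarUnitary d) :=
  hf.integrable_of_hasCompactSupport (HasCompactSupport.of_compactSpace f)

/-- The column `U|b⟩` of a unitary matrix. -/
def unitaryColumn {d : ℕ} (b : Fin d) (U : UnitaryMat d) (i : Fin d) : ℂ :=
  (U : Matrix (Fin d) (Fin d) ℂ) i b

theorem continuous_unitaryColumn {d : ℕ} (b i : Fin d) :
    Continuous fun U : UnitaryMat d => unitaryColumn b U i :=
  continuous_subtype_val.matrix_elem i b

theorem sum_norm_sq_unitaryColumn {d : ℕ} (b : Fin d) (U : UnitaryMat d) :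
    ∑ i, ‖unitaryColumn b U i‖ ^ 2 = 1 := by
  have h : (U : Matrix (Fin d) (Fin d) ℂ)ᴴ * (U : Matrix (Fin d) (Fin d) ℂ) = 1 :=
    Matrix.UnitaryGroup.star_mul_self U
  have h2 := congrFun (congrFun h b) b
  simp only [Matrix.mul_apply, Matrix.conjTranspose_apply, Matrix.one_apply_eq] at h2
  have h3 : ((∑ i, ‖unitaryColumn b U i‖ ^ 2 : ℝ) : ℂ) = 1 := by
    rw [← h2]
    push_cast
    refine Finset.sum_congr rfl fun i _ => ?_
    rw [← Complex.conj_mul' (unitaryColumn b U i)]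
    rfl
  exact_mod_cast h3

theorem integral_unitaryColumn_mulVec {d : ℕ} {F : Type*} [NormedAddCommGroup F] [NormedSpace ℝ F]
    (b : Fin d) (W : UnitaryMat d) (f : (Fin d → ℂ) → F) :
    ∫ U, f ((W : Matrix (Fin d) (Fin d) ℂ) *ᵥ unitaryColumn b U) ∂haarUnitary d =
      ∫ U, f (unitaryColumn b U) ∂haarUnitary d :=
  integral_mul_left_eq_self (fun U => f (unitaryColumn b U)) W

/-- The complex reflection `1 - t|w⟩⟨w|`. -/
theorem reflection_mem_unitaryGroup {d : ℕ} (w : Fin d → ℂ) (t : ℂ) (ht : star t = t)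
    (h : t * (star w ⬝ᵥ w) = 2) :
    (1 - t • Matrix.vecMulVec w (star w)) ∈ Matrix.unitaryGroup (Fin d) ℂ := by
  rw [Matrix.mem_unitaryGroup_iff, star_sub, star_one, star_smul, ht, Matrix.star_eq_conjTranspose,
    Matrix.conjTranspose_vecMulVec, star_star, sub_mul, mul_sub, mul_sub, smul_mul_smul_comm,
    Matrix.vecMulVec_mul_vecMulVec, one_mul, mul_one, one_mul, Matrix.vecMulVec_smul, smul_smul,
    mul_assoc, h, mul_comm t 2, mul_smul, two_smul]
  abel

theorem reflection_mulVec {d : ℕ} (w : Fin d → ℂ) (t : ℂ) (v : Fin d → ℂ) :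
    (1 - t • Matrix.vecMulVec w (star w)) *ᵥ v = v - (t * (star w ⬝ᵥ v)) • w := by
  rw [Matrix.sub_mulVec, Matrix.one_mulVec, Matrix.smul_mulVec, Matrix.vecMulVec_mulVec]
  ext i
  simp
  ring

/-- One family of unitaries suffices for all mixing of coordinates: suitable `w` and `t` give both
the exchange of two coordinates and the `3-4-5` rotations, with rational coefficients. -/
theorem integral_unitaryColumn_reflection {d : ℕ} {F : Type*} [NormedAddCommGroup F]
    [NormedSpace ℝ F] (b : Fin d) (w : Fin d → ℂ) (t : ℂ) (ht : star t = t)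
    (h : t * (star w ⬝ᵥ w) = 2) (f : (Fin d → ℂ) → F) :
    ∫ U, f (unitaryColumn b U - (t * (star w ⬝ᵥ unitaryColumn b U)) • w) ∂haarUnitary d =
      ∫ U, f (unitaryColumn b U) ∂haarUnitary d := by
  rw [← integral_unitaryColumn_mulVec b ⟨_, reflection_mem_unitaryGroup w t ht h⟩ f]
  simp only [reflection_mulVec]

/-- Exchanging two coordinates. -/
theorem integral_unitaryColumn_swap {d : ℕ} {F : Type*} [NormedAddCommGroup F]
    [NormedSpace ℝ F] (b : Fin d) {i j : Fin d} (hij : i ≠ j) (f : ℂ → ℂ → F) :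
    ∫ U, f (unitaryColumn b U j) (unitaryColumn b U i) ∂haarUnitary d =
      ∫ U, f (unitaryColumn b U i) (unitaryColumn b U j) ∂haarUnitary d := by
  rw [← integral_unitaryColumn_reflection b (Pi.single i 1 - Pi.single j 1) 1 (by simp)
    (by simp [dotProduct_sub, hij, hij.symm]; norm_num)
    (fun v => f (v i) (v j))]
  simp [sub_dotProduct, hij, hij.symm, Pi.star_single]

/-- The rotation by a `3-4-5` angle in the plane of two coordinates. -/
theorem integral_unitaryColumn_rotate {d : ℕ} {F : Type*} [NormedAddCommGroup F]
    [NormedSpace ℝ F] (b : Fin d) {i j : Fin d} (hij : i ≠ j) (ω : ℂ) (hω : star ω * ω = 1)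
    (f : ℂ → F) :
    ∫ U, f ((3 * unitaryColumn b U i + 4 * ω * unitaryColumn b U j) / 5) ∂haarUnitary d =
      ∫ U, f (unitaryColumn b U i) ∂haarUnitary d := by
  have hω' : (starRingEnd ℂ) ω * ω = 1 := hω
  -- Here `⟨w|w⟩ = 5`, so `t = 2/5` is forced, and coordinate `i` becomes `v i - (2/5)(v i - 2 ω v
  -- j) = (3 v i + 4 ω v j) / 5`.
  rw [← integral_unitaryColumn_reflection b (Pi.single i 1 - Pi.single j (2 * star ω)) (2 / 5)
    (by simp) (by
      simp [dotProduct_sub, hij, hij.symm, Pi.star_single]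
      linear_combination (2 / 5 * 4) * hω') (fun v => f (v i))]
  congr 1
  ext U
  congr 1
  simp [sub_dotProduct, hij, Pi.star_single]
  ring

/-- A phase on one coordinate. -/
theorem integral_unitaryColumn_phase {d : ℕ} {F : Type*} [NormedAddCommGroup F]
    [NormedSpace ℝ F] (b a : Fin d) (f : (Fin d → ℂ) → F) :
    ∫ U, f (fun i => (if i = a then Complex.I else 1) * unitaryColumn b U i) ∂haarUnitary d =
      ∫ U, f (unitaryColumn b U) ∂haarUnitary d := by
  have hW : Matrix.diagonal (fun i : Fin d => if i = a then Complex.I else 1) ∈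
      Matrix.unitaryGroup (Fin d) ℂ := by
    rw [Matrix.mem_unitaryGroup_iff, Matrix.star_eq_conjTranspose, Matrix.diagonal_conjTranspose,
      Matrix.diagonal_mul_diagonal, ← Matrix.diagonal_one]
    congr 1
    ext i
    by_cases h : i = a <;> simp [h]
  rw [← integral_unitaryColumn_mulVec b ⟨_, hW⟩ f]
  congr 1
  ext U
  congr 1
  ext i
  exact (Matrix.mulVec_diagonal (fun i : Fin d => if i = a then Complex.I else 1) _ i).symm

/-! ### Moments of a coordinate of a Haar random unit vector -/

/-- The squared modulus of a coordinate of a column of a unitary matrix. -/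
noncomputable def columnWeight {d : ℕ} (b i : Fin d) (U : UnitaryMat d) : ℝ :=
  ‖unitaryColumn b U i‖ ^ 2

theorem columnWeight_nonneg {d : ℕ} (b i : Fin d) (U : UnitaryMat d) : 0 ≤ columnWeight b i U :=
  sq_nonneg _

theorem continuous_columnWeight {d : ℕ} (b i : Fin d) :
    Continuous fun U : UnitaryMat d => columnWeight b i U :=
  (continuous_unitaryColumn b i).norm.pow 2

theorem integrable_columnWeight_mul {d : ℕ} (b i j : Fin d) (k l : ℕ) :
    Integrable (fun U => columnWeight b i U ^ k * columnWeight b j U ^ l) (haarUnitary d) :=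
  integrable_haarUnitary_of_continuous
    (((continuous_columnWeight b i).pow k).mul ((continuous_columnWeight b j).pow l))

/-- The mixed moments of the squared moduli of two coordinates. -/
noncomputable def columnMoment {d : ℕ} (b i j : Fin d) (k l : ℕ) : ℝ :=
  ∫ U, columnWeight b i U ^ k * columnWeight b j U ^ l ∂haarUnitary d

theorem columnMoment_nonneg {d : ℕ} (b i j : Fin d) (k l : ℕ) : 0 ≤ columnMoment b i j k l :=
  integral_nonneg fun U =>
    mul_nonneg (pow_nonneg (columnWeight_nonneg b i U) k) (pow_nonneg (columnWeight_nonneg b j U) l)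

theorem columnMoment_swap {d : ℕ} (b : Fin d) {i j : Fin d} (hij : i ≠ j) (k l : ℕ) :
    columnMoment b i j k l = columnMoment b i j l k := by
  unfold columnMoment columnWeight
  rw [← integral_unitaryColumn_swap b hij fun x y => (‖x‖ ^ 2) ^ k * (‖y‖ ^ 2) ^ l]
  simp only [mul_comm]

theorem norm_sq_rotate (a b : ℂ) (ω : ℂ) (hω : star ω * ω = 1) :
    ‖(3 * a + 4 * ω * b) / 5‖ ^ 2 =
      (9 * ‖a‖ ^ 2 + 16 * ‖b‖ ^ 2 + 24 * (star a * (ω * b)).re) / 25 := by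
  have h1 : ω.re ^ 2 + ω.im ^ 2 = 1 := by
    have := congrArg Complex.re hω
    simp at this
    linarith
  simp only [Complex.sq_norm, Complex.normSq_apply]
  simp
  ring_nf
  linear_combination (16 / 25 * (b.re ^ 2 + b.im ^ 2)) * h1

/-- The invariance of the moments under the `3-4-5` rotations, averaged over four phases. -/
theorem integral_rotate_average {d : ℕ} (b : Fin d) {i j : Fin d} (hij : i ≠ j) (k : ℕ) :
    ∃ p q : UnitaryMat d → ℝ, (∀ U, p U ^ 2 + q U ^ 2 = columnWeight b i U * columnWeight b j U) ∧
      Continuous p ∧ Continuous q ∧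
      4 * 25 ^ k * columnMoment b i j k 0 =
        ∫ U, ((9 * columnWeight b i U + 16 * columnWeight b j U + 24 * p U) ^ k +
          (9 * columnWeight b i U + 16 * columnWeight b j U - 24 * p U) ^ k +
          ((9 * columnWeight b i U + 16 * columnWeight b j U + 24 * q U) ^ k +
          (9 * columnWeight b i U + 16 * columnWeight b j U - 24 * q U) ^ k)) ∂haarUnitary d := by
  have hi := continuous_unitaryColumn b i
  have hj := continuous_unitaryColumn b j
  have hc : Continuous fun U : UnitaryMat d => star (unitaryColumn b U i) * unitaryColumn b U j := by
    fun_prop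
  have key : ∀ ω : ℂ, star ω * ω = 1 → 25 ^ k * columnMoment b i j k 0 =
      ∫ U, (9 * columnWeight b i U + 16 * columnWeight b j U +
        24 * (star (unitaryColumn b U i) * (ω * unitaryColumn b U j)).re) ^ k ∂haarUnitary d := by
    intro ω hω
    have h := integral_unitaryColumn_rotate b hij ω hω (fun z => (‖z‖ ^ 2) ^ k)
    simp only [norm_sq_rotate _ _ _ hω, div_pow, integral_div] at h
    rw [columnMoment]
    simp only [pow_zero, mul_one]
    rw [div_eq_iff (by positivity)] at h
    rw [mul_comm]
    exact h.symm
  have hc1 : Continuous fun U : UnitaryMat d =>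
      (star (unitaryColumn b U i) * unitaryColumn b U j).re := Complex.continuous_re.comp hc
  have hc2 : Continuous fun U : UnitaryMat d =>
      (star (unitaryColumn b U i) * unitaryColumn b U j).im := Complex.continuous_im.comp hc
  have hw1 := continuous_columnWeight b i
  have hw2 := continuous_columnWeight b j
  -- `p` and `q` are the real and imaginary parts of `conj (v i) * v j`. The phases `±1` and `±i`
  -- turn the cross term into `±p` and `±q`, so odd powers cancel in the sum.
  refine ⟨_, _, fun U => ?_, hc1, hc2, ?_⟩
  · rw [columnWeight, columnWeight, ← mul_pow, ← norm_star (unitaryColumn b U i), ← norm_mul,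
      Complex.sq_norm, Complex.normSq_apply]
    ring
  · have k1 := key 1 (by simp)
    have k2 := key (-1) (by simp)
    have k3 := key Complex.I (by simp)
    have k4 := key (-Complex.I) (by simp)
    rw [integral_add, integral_add, integral_add]
    · have e1 : ∀ z w : ℂ, (z * (1 * w)).re = (z * w).re := by intro z w; rw [one_mul]
      have e2 : ∀ z w : ℂ, (z * (-1 * w)).re = -(z * w).re := by intro z w; simp
      have e3 : ∀ z w : ℂ, (z * (Complex.I * w)).re = -(z * w).im := by intro z w; simp; ring
      have e4 : ∀ z w : ℂ, (z * (-Complex.I * w)).re = (z * w).im := by intro z w; simp; ring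
      simp only [e1] at k1
      simp only [e2, mul_neg, ← sub_eq_add_neg] at k2
      simp only [e3, mul_neg, ← sub_eq_add_neg] at k3
      simp only [e4] at k4
      rw [← k1, ← k2, ← k3, ← k4]
      ring
    all_goals apply integrable_haarUnitary_of_continuous; fun_prop

theorem integral_polynomial_columnWeight {d : ℕ} (b i j : Fin d) (n : ℕ) (c : Fin n → ℝ)
    (k l : Fin n → ℕ) :
    ∫ U, ∑ r, c r * (columnWeight b i U ^ k r * columnWeight b j U ^ l r) ∂haarUnitary d =
      ∑ r, c r * columnMoment b i j (k r) (l r) := by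
  rw [integral_finsetSum _ fun r _ => (integrable_columnWeight_mul b i j _ _).const_mul _]
  simp only [integral_const_mul, columnMoment]

theorem columnMoment_left {d : ℕ} (b i j j' : Fin d) (k : ℕ) :
    columnMoment b i j k 0 = columnMoment b i j' k 0 := by
  simp [columnMoment]

/-- For squares, `p` and `q` enter the phase average only through `p² + q²`, the product of the two
weights. What remains is a linear relation between the mixed moments, closed by the exchange
symmetry. The third moment works in the same way. -/
theorem columnMoment_two {d : ℕ} (b : Fin d) {i j : Fin d} (hij : i ≠ j) :
    columnMoment b i j 2 0 = 2 * columnMoment b i j 1 1 := by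
  obtain ⟨p, q, hpq, -, -, h⟩ := integral_rotate_average b hij 2
  have h2 := integral_polynomial_columnWeight b i j 3 ![4 * 81, 4 * 576, 4 * 256] ![2, 1, 0]
    ![0, 1, 2]
  rw [integral_congr_ae (g := fun U => ∑ r : Fin 3, (![4 * 81, 4 * 576, 4 * 256] : Fin 3 → ℝ) r *
    (columnWeight b i U ^ (![2, 1, 0] : Fin 3 → ℕ) r *
      columnWeight b j U ^ (![0, 1, 2] : Fin 3 → ℕ) r)) (.of_forall fun U => by
      have := hpq U
      simp [Fin.sum_univ_three]
      linear_combination 1152 * this), h2] at h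
  simp [Fin.sum_univ_three] at h
  rw [columnMoment_swap b hij 0 2] at h
  linarith

theorem columnMoment_three {d : ℕ} (b : Fin d) {i j : Fin d} (hij : i ≠ j) :
    columnMoment b i j 3 0 = 3 * columnMoment b i j 2 1 := by
  obtain ⟨p, q, hpq, -, -, h⟩ := integral_rotate_average b hij 3
  have h2 := integral_polynomial_columnWeight b i j 4 ![4 * 729, 4 * 11664, 4 * 20736, 4 * 4096]
    ![3, 2, 1, 0] ![0, 1, 2, 3]
  rw [integral_congr_ae (g := fun U => ∑ r : Fin 4,
    (![4 * 729, 4 * 11664, 4 * 20736, 4 * 4096] : Fin 4 → ℝ) r *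
    (columnWeight b i U ^ (![3, 2, 1, 0] : Fin 4 → ℕ) r *
      columnWeight b j U ^ (![0, 1, 2, 3] : Fin 4 → ℕ) r)) (.of_forall fun U => by
      have := hpq U
      simp [Fin.sum_univ_four]
      linear_combination 6 * 576 * (9 * columnWeight b i U + 16 * columnWeight b j U) * this),
    h2] at h
  simp [Fin.sum_univ_four] at h
  rw [columnMoment_swap b hij 0 3, columnMoment_swap b hij 1 2] at h
  linarith

/-- Four phases do not determine `p⁴ + q⁴`, which is only bounded by `(x y)²`, so equality is lost
here. Replacing every `x² y²` by `(x³ y + x y³) / 2` then leaves `318528 μ₄₀ ≤ 1564416 μ₃₁`, with a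
ratio below `5`. The slack costs a constant factor, not the order in `d`. -/
theorem columnMoment_four_le {d : ℕ} (b : Fin d) {i j : Fin d} (hij : i ≠ j) :
    columnMoment b i j 4 0 ≤ 5 * columnMoment b i j 3 1 := by
  obtain ⟨p, q, hpq, hp, hq, h⟩ := integral_rotate_average b hij 4
  have h2 := integral_polynomial_columnWeight b i j 4
    ![4 * 6561, 4 * 580608, 4 * 983808 , 4 * 65536]
    ![4, 3, 1, 0] ![0, 1, 3, 4]
  have hw1 := continuous_columnWeight b i
  have hw2 := continuous_columnWeight b j
  have h3 : 4 * 25 ^ 4 * columnMoment b i j 4 0 ≤ ∫ U, ∑ r : Fin 4,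
    (![4 * 6561, 4 * 580608, 4 * 983808 , 4 * 65536] : Fin 4 → ℝ) r *
    (columnWeight b i U ^ (![4, 3, 1, 0] : Fin 4 → ℕ) r *
      columnWeight b j U ^ (![0, 1, 3, 4] : Fin 4 → ℕ) r) ∂haarUnitary d := by
    rw [h]
    refine integral_mono (integrable_haarUnitary_of_continuous (by fun_prop))
      (integrable_haarUnitary_of_continuous (by fun_prop)) fun U => ?_
    have hx := columnWeight_nonneg b i U
    have hy := columnWeight_nonneg b j U
    have e := hpq U
    simp only [Fin.sum_univ_four, Matrix.cons_val, pow_zero, mul_one, one_mul, pow_one]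
    generalize columnWeight b i U = x at *
    generalize columnWeight b j U = y at *
    generalize p U = p at *
    generalize q U = q at *
    have e2 : p ^ 4 + q ^ 4 ≤ (x * y) ^ 2 := by
      rw [← e]; nlinarith [mul_nonneg (sq_nonneg p) (sq_nonneg q)]
    have e3 : 2 * (x * y) ^ 2 ≤ x ^ 3 * y + x * y ^ 3 := by
      nlinarith [mul_nonneg (mul_nonneg hx hy) (sq_nonneg (x - y))]
    have e4 : (9 * x + 16 * y + 24 * p) ^ 4 + (9 * x + 16 * y - 24 * p) ^ 4 +
        ((9 * x + 16 * y + 24 * q) ^ 4 + (9 * x + 16 * y - 24 * q) ^ 4) =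
        4 * (9 * x + 16 * y) ^ 4 + 12 * 576 * (9 * x + 16 * y) ^ 2 * (p ^ 2 + q ^ 2) +
          2 * 331776 * (p ^ 4 + q ^ 4) := by ring
    rw [e4, e]
    nlinarith
  rw [h2] at h3
  simp [Fin.sum_univ_four] at h3
  rw [columnMoment_swap b hij 0 4, columnMoment_swap b hij 1 3] at h3
  have := columnMoment_nonneg b i j 3 1
  linarith

/-- Insert `1 = ∑ j, |v j|²` into the integrand. This couples consecutive moments of one coordinate.
-/
theorem columnMoment_eq_sum {d : ℕ} (b i : Fin d) (k : ℕ) :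
    columnMoment b i i k 0 = columnMoment b i i (k + 1) 0 +
      ∑ j ∈ Finset.univ.erase i, columnMoment b i j k 1 := by
  have h : columnMoment b i i k 0 = ∑ j, columnMoment b i j k 1 := by
    unfold columnMoment
    rw [← integral_finsetSum _ fun j _ => integrable_columnWeight_mul b i j k 1]
    congr 1
    ext U
    rw [← Finset.mul_sum]
    have := sum_norm_sq_unitaryColumn b U
    simp only [pow_one, columnWeight, this, pow_zero]
  rw [h, ← Finset.add_sum_erase _ _ (Finset.mem_univ i)]
  congr 1
  simp [columnMoment, pow_succ]

/-- In the normalization identity each of the `d - 1` terms with `j ≠ i` is at least `μ_{k+1} / c`,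
when `c > 0`. Iterating with `c = 3` and `c = 5` yields the factors `d + 2` and `d + 4` of the
fourth-moment bound. -/
theorem columnMoment_recursion_le {d : ℕ} (b i : Fin d) (k : ℕ) (c : ℝ)
    (h : ∀ j, i ≠ j → columnMoment b i j (k + 1) 0 ≤ c * columnMoment b i j k 1) :
    ((d : ℝ) - 1 + c) * columnMoment b i i (k + 1) 0 ≤ c * columnMoment b i i k 0 := by
  have h1 : (d - 1 : ℝ) * columnMoment b i i (k + 1) 0 ≤
      ∑ j ∈ Finset.univ.erase i, c * columnMoment b i j k 1 := by
    have := Finset.card_nsmul_le_sum (Finset.univ.erase i) (fun j => c * columnMoment b i j k 1)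
      (columnMoment b i i (k + 1) 0) (fun j hj => by
        rw [columnMoment_left b i i j]; exact h j (Finset.ne_of_mem_erase hj).symm)
    rw [Finset.card_erase_of_mem (Finset.mem_univ i), Finset.card_univ, Fintype.card_fin,
      nsmul_eq_mul, Nat.cast_sub (by have := i.2; omega)] at this
    simpa using this
  rw [columnMoment_eq_sum b i k, mul_add, Finset.mul_sum]
  linarith

theorem columnMoment_one {d : ℕ} (b i : Fin d) : columnMoment b i i 1 0 = 1 / d := by
  have hd : (d : ℝ) ≠ 0 := Nat.cast_ne_zero.mpr i.pos.ne'
  have h := columnMoment_eq_sum b i 0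
  rw [Finset.sum_congr rfl (g := fun _ => columnMoment b i i 1 0) fun j hj => by
      rw [columnMoment_swap b (Finset.ne_of_mem_erase hj).symm, columnMoment_left b i j i],
    Finset.sum_const, Finset.card_erase_of_mem (Finset.mem_univ i), Finset.card_univ,
    Fintype.card_fin, nsmul_eq_mul, Nat.cast_sub (by have := i.2; omega)] at h
  simp only [columnMoment, pow_zero, mul_one, integral_const, probReal_univ, smul_eq_mul,
    Nat.cast_one, zero_add] at h ⊢
  rw [eq_div_iff hd]
  linarith

theorem columnMoment_two_eq {d : ℕ} (b i : Fin d) :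
    columnMoment b i i 2 0 = 2 / (d * (d + 1)) := by
  have hd : (d : ℝ) ≠ 0 := Nat.cast_ne_zero.mpr i.pos.ne'
  have h := columnMoment_eq_sum b i 1
  rw [Finset.sum_congr rfl (g := fun _ => columnMoment b i i 2 0 / 2) fun j hj => by
      rw [columnMoment_left b i i j 2, columnMoment_two b (Finset.ne_of_mem_erase hj).symm]
      ring,
    Finset.sum_const, Finset.card_erase_of_mem (Finset.mem_univ i), Finset.card_univ,
    Fintype.card_fin, nsmul_eq_mul, Nat.cast_sub (by have := i.2; omega),
    columnMoment_one] at h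
  have hd1 : (d : ℝ) + 1 ≠ 0 := by positivity
  field_simp at h ⊢
  push_cast at h
  linarith

theorem columnMoment_one_one {d : ℕ} (b i j : Fin d) :
    columnMoment b i j 1 1 = (1 + if i = j then 1 else 0) / (d * (d + 1)) := by
  split_ifs with hij
  · subst hij
    have : columnMoment b i i 1 1 = columnMoment b i i 2 0 := by simp [columnMoment, sq]
    rw [this, columnMoment_two_eq]
    norm_num
  · have h := columnMoment_two b hij
    rw [columnMoment_left b i j i, columnMoment_two_eq] at h
    linear_combination (-1 / 2) * h

theorem columnMoment_four_bound {d : ℕ} (b i : Fin d) :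
    columnMoment b i i 4 0 ≤ 30 / (d * (d + 1) * ((d + 2) * (d + 4))) := by
  have hd : 0 < (d : ℝ) := Nat.cast_pos.mpr i.pos
  have h3 := columnMoment_recursion_le b i 2 3 fun j hj => (columnMoment_three b hj).le
  have h4 := columnMoment_recursion_le b i 3 5 fun j hj => columnMoment_four_le b hj
  rw [columnMoment_two_eq] at h3
  norm_num at h3 h4
  have h5 : columnMoment b i i 3 0 ≤ 3 * (2 / (d * (d + 1))) / (d + 2) := by
    rw [le_div_iff₀ (by positivity)]; linarith
  have h6 : columnMoment b i i 4 0 ≤ 5 * columnMoment b i i 3 0 / (d + 4) := by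
    rw [le_div_iff₀ (by positivity)]; linarith
  calc _ ≤ _ := h6
    _ ≤ 5 * (3 * (2 / (d * (d + 1))) / (d + 2)) / (d + 4) := by gcongr
    _ = _ := by field_simp; norm_num

/-! ### Moments of quadratic forms in a Haar random unit vector -/

/-- If the phase factor differs from `1`, the moment vanishes. A suitable choice of `a` achieves
this for every unbalanced index pattern, even when `i = k`, where the factor is `i² = -1`. -/
theorem integral_column_phase_factor {d : ℕ} (b a i j k l : Fin d) :
    ((if i = a then Complex.I else 1) * star (if j = a then Complex.I else 1) *
        ((if k = a then Complex.I else 1) * star (if l = a then Complex.I else 1))) *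
      ∫ U, unitaryColumn b U i * star (unitaryColumn b U j) *
        (unitaryColumn b U k * star (unitaryColumn b U l)) ∂haarUnitary d =
      ∫ U, unitaryColumn b U i * star (unitaryColumn b U j) *
        (unitaryColumn b U k * star (unitaryColumn b U l)) ∂haarUnitary d := by
  rw [← integral_const_mul, ← integral_unitaryColumn_phase b a (fun v : Fin d → ℂ =>
    v i * star (v j) * (v k * star (v l)))]
  congr 1
  ext U
  simp only [star_mul']
  ring

theorem integral_column_second_moment {d : ℕ} (b i j k l : Fin d) :
    ∫ U, unitaryColumn b U i * star (unitaryColumn b U j) *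
        (unitaryColumn b U k * star (unitaryColumn b U l)) ∂haarUnitary d =
      ((if i = j ∧ k = l then 1 else 0) + (if i = l ∧ k = j then 1 else 0)) /
        ((d : ℂ) * (d + 1)) := by
  have hdiag : ∀ i k : Fin d, ∫ U, unitaryColumn b U i * star (unitaryColumn b U i) *
        (unitaryColumn b U k * star (unitaryColumn b U k)) ∂haarUnitary d =
      (1 + if i = k then 1 else 0) / ((d : ℂ) * (d + 1)) := by
    intro i k
    have h := columnMoment_one_one b i k
    have h' := congrArg (fun r : ℝ => (r : ℂ)) h
    simp only [columnMoment, columnWeight, pow_one, ← integral_complex_ofReal] at h'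
    push_cast at h'
    rw [apply_ite (fun r : ℝ => (r : ℂ))] at h'
    rw [show (1 + if i = k then (1 : ℂ) else 0) =
      1 + (if i = k then ((1 : ℝ) : ℂ) else ((0 : ℝ) : ℂ)) by simp, ← h']
    congr 1
    ext U
    rw [← Complex.mul_conj', ← Complex.mul_conj']
    rfl
  have hph := fun a => integral_column_phase_factor b a i j k l
  have hz : ∀ {z x : ℂ}, z * x = x → z ≠ 1 → x = 0 := by
    intro z x h hz
    have : (z - 1) * x = 0 := by rw [sub_mul, h]; ring
    exact (mul_eq_zero.mp this).resolve_left (sub_ne_zero.mpr hz)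
  by_cases hij : i = j
  · subst hij
    by_cases hkl : k = l
    · subst hkl
      rw [hdiag]
      by_cases hik : i = k <;> simp [hik]
    · have h := hz (hph k) (by
        have hlk : l ≠ k := fun h => hkl h.symm
        by_cases hik : i = k <;> simp [hlk, hik, Complex.ext_iff])
      rw [h]
      have : ¬ (i = l ∧ k = i) := fun h => hkl (h.2.trans h.1)
      simp [hkl, this]
  · have hji : j ≠ i := fun h => hij h.symm
    by_cases hil : i = l
    · subst hil
      by_cases hkj : k = j
      · subst hkj
        have : ∀ U : UnitaryMat d, unitaryColumn b U i * star (unitaryColumn b U k) *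
          (unitaryColumn b U k * star (unitaryColumn b U i)) =
          unitaryColumn b U i * star (unitaryColumn b U i) *
          (unitaryColumn b U k * star (unitaryColumn b U k)) := fun U => by ring
        simp only [this, hdiag]
        simp [hij]
      · have hjk : j ≠ k := fun h => hkj h.symm
        have h := hz (hph k) (by
          by_cases hik : i = k <;> simp [hjk, hik, Complex.ext_iff])
        rw [h]
        simp [hkj, hij]
    · have hli : l ≠ i := fun h => hil h.symm
      have h := hz (hph i) (by
        by_cases hki : k = i <;> simp [hki, hji, hli, Complex.ext_iff]; norm_num)
      rw [h]
      simp [hij, hil]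

/-- The quadratic form `⟨v|A|v⟩`. -/
def quadForm {d : ℕ} (A : Matrix (Fin d) (Fin d) ℂ) (v : Fin d → ℂ) : ℂ :=
  star v ⬝ᵥ A *ᵥ v

theorem quadForm_eq_sum {d : ℕ} (A : Matrix (Fin d) (Fin d) ℂ) (v : Fin d → ℂ) :
    quadForm A v = ∑ x : Fin d × Fin d, A x.2 x.1 * (v x.1 * star (v x.2)) := by
  rw [quadForm, Fintype.sum_prod_type_right]
  simp only [dotProduct, Matrix.mulVec, Finset.mul_sum, Pi.star_apply]
  exact Finset.sum_congr rfl fun i _ => Finset.sum_congr rfl fun j _ => by ring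

theorem continuous_quadForm_unitaryColumn {d : ℕ} (A : Matrix (Fin d) (Fin d) ℂ) (b : Fin d) :
    Continuous fun U : UnitaryMat d => quadForm A (unitaryColumn b U) := by
  have := fun i => continuous_unitaryColumn b i
  simp only [quadForm_eq_sum]
  fun_prop

/-- Kept general in the coefficients because it is used twice: for a product of quadratic forms, and
for `tr E(ψ)²`, where the coefficients are traces of products of channel outputs. -/
theorem integral_bilinear_column {d : ℕ} {ι κ : Type*} [Fintype ι] [Fintype κ] (b : Fin d)
    (c : ι → κ → ℂ) (i j : ι → Fin d) (k l : κ → Fin d) :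
    ∫ U, ∑ x, ∑ y, c x y * (unitaryColumn b U (i x) * star (unitaryColumn b U (j x)) *
        (unitaryColumn b U (k y) * star (unitaryColumn b U (l y)))) ∂haarUnitary d =
      ∑ x, ∑ y, c x y * (((if i x = j x ∧ k y = l y then 1 else 0) +
        (if i x = l y ∧ k y = j x then 1 else 0)) / ((d : ℂ) * (d + 1))) := by
  have := fun i => continuous_unitaryColumn b i
  rw [integral_finsetSum _ fun x _ => integrable_haarUnitary_of_continuous (by fun_prop)]
  refine Finset.sum_congr rfl fun x _ => ?_
  rw [integral_finsetSum _ fun y _ => integrable_haarUnitary_of_continuous (by fun_prop)]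
  refine Finset.sum_congr rfl fun y _ => ?_
  rw [integral_const_mul, integral_column_second_moment]

theorem integral_quadForm_mul {d : ℕ} (A B : Matrix (Fin d) (Fin d) ℂ) (b : Fin d) :
    ∫ U, quadForm A (unitaryColumn b U) * quadForm B (unitaryColumn b U) ∂haarUnitary d =
      (A.trace * B.trace + (A * B).trace) / ((d : ℂ) * (d + 1)) := by
  have h := integral_bilinear_column b (fun x y : Fin d × Fin d => A x.2 x.1 * B y.2 y.1)
    Prod.fst Prod.snd Prod.fst Prod.snd
  simp only [quadForm_eq_sum, Finset.sum_mul_sum]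
  refine Eq.trans ?_ (h.trans ?_)
  · congr 1
    ext U
    exact Finset.sum_congr rfl fun x _ => Finset.sum_congr rfl fun y _ => by ring
  · simp only [mul_div_assoc', ← Finset.sum_div]
    congr 1
    simp only [mul_add, Finset.sum_add_distrib, Fintype.sum_prod_type, Matrix.trace,
      Matrix.mul_apply, Matrix.diag_apply, Finset.sum_mul_sum]
    congr 1
    · simp only [ite_and, mul_ite, mul_one, mul_zero, Finset.sum_ite_irrel, Finset.sum_ite_eq,
        Finset.sum_const_zero, Finset.mem_univ, if_true]
    · simp only [ite_and, mul_ite, mul_one, mul_zero, Finset.sum_ite_eq,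
        Finset.sum_ite_eq', Finset.mem_univ, if_true]
      rw [Finset.sum_comm]

theorem quadForm_nonneg {d : ℕ} {A : Matrix (Fin d) (Fin d) ℂ} (hA : A.PosSemidef)
    (v : Fin d → ℂ) : 0 ≤ quadForm A v :=
  hA.dotProduct_mulVec_nonneg v

/-- Cauchy–Schwarz for weights of total mass at most one, applied twice: once to `x`, once to `x²`.
-/
theorem pow_four_sum_le {ι : Type*} (s : Finset ι) (w x : ι → ℝ) (hw : ∀ i, 0 ≤ w i)
    (hs : ∑ i ∈ s, w i ≤ 1) : (∑ i ∈ s, w i * x i) ^ 4 ≤ ∑ i ∈ s, w i * x i ^ 4 := by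
  have key : ∀ y : ι → ℝ, (∑ i ∈ s, w i * y i) ^ 2 ≤ ∑ i ∈ s, w i * y i ^ 2 := by
    intro y
    have h := Finset.sum_sq_le_sum_mul_sum_of_sq_le_mul s (r := fun i => w i * y i) (f := w)
      (g := fun i => w i * y i ^ 2) (fun i _ => hw i)
      (fun i _ => mul_nonneg (hw i) (sq_nonneg _)) (fun i _ => le_of_eq (by ring))
    have h2 : 0 ≤ ∑ i ∈ s, w i * y i ^ 2 :=
      Finset.sum_nonneg fun i _ => mul_nonneg (hw i) (sq_nonneg _)
    nlinarith
  calc (∑ i ∈ s, w i * x i) ^ 4 = ((∑ i ∈ s, w i * x i) ^ 2) ^ 2 := by ring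
    _ ≤ (∑ i ∈ s, w i * x i ^ 2) ^ 2 := by gcongr; exact key x
    _ ≤ _ := by
      refine (key fun i => x i ^ 2).trans_eq (Finset.sum_congr rfl fun i _ => by ring)

/-- By invariance the random vector may be expressed in an eigenbasis of `A`, where the quadratic
form is a sub-convex combination of the weights `|v i|²`. Convexity of the fourth power reduces the
claim to a single coordinate. -/
theorem integral_quadForm_pow_four_le {d : ℕ} {A : Matrix (Fin d) (Fin d) ℂ} (hA : A.PosSemidef)
    (htr : A.trace.re ≤ 1) (b : Fin d) :
    ∫ U, (quadForm A (unitaryColumn b U)).re ^ 4 ∂haarUnitary d ≤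
      30 / (d * (d + 1) * ((d + 2) * (d + 4))) := by
  set W := hA.1.eigenvectorUnitary with hW
  set lam := hA.1.eigenvalues with hlam
  have hlam0 : ∀ i, 0 ≤ lam i := hA.eigenvalues_nonneg
  have hsum : ∑ i, lam i ≤ 1 := by
    rw [hA.1.trace_eq_sum_eigenvalues] at htr
    simpa using htr
  have hform : ∀ v, (quadForm A ((W : Matrix (Fin d) (Fin d) ℂ) *ᵥ v)).re =
      ∑ i, lam i * ‖v i‖ ^ 2 := by
    intro v
    have h1 : A = (W : Matrix (Fin d) (Fin d) ℂ) *
        Matrix.diagonal (fun i => (lam i : ℂ)) * (W : Matrix (Fin d) (Fin d) ℂ)ᴴ :=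
      hA.1.spectral_theorem
    have h2 : (W : Matrix (Fin d) (Fin d) ℂ)ᴴ * (W : Matrix (Fin d) (Fin d) ℂ) = 1 :=
      Matrix.UnitaryGroup.star_mul_self W
    have h3 : quadForm A ((W : Matrix (Fin d) (Fin d) ℂ) *ᵥ v) =
        star v ⬝ᵥ Matrix.diagonal (fun i => (lam i : ℂ)) *ᵥ v := by
      rw [quadForm, Matrix.star_mulVec, ← Matrix.dotProduct_mulVec, Matrix.mulVec_mulVec,
        Matrix.mulVec_mulVec]
      congr 2
      conv_lhs => rw [h1]
      rw [mul_assoc, mul_assoc, h2, mul_one, ← mul_assoc, h2, one_mul]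
    rw [h3]
    simp only [dotProduct, Matrix.mulVec_diagonal, Complex.re_sum]
    refine Finset.sum_congr rfl fun i _ => ?_
    rw [Pi.star_apply, mul_left_comm, Complex.re_ofReal_mul]
    congr 1
    have := Complex.conj_mul' (v i)
    change ((starRingEnd ℂ) (v i) * v i).re = _
    rw [this]
    norm_cast
  rw [← integral_unitaryColumn_mulVec b W fun v => (quadForm A v).re ^ 4]
  have hw := fun i => continuous_columnWeight b i
  calc _ ≤ ∫ U, ∑ i, lam i * columnWeight b i U ^ 4 ∂haarUnitary d := by
        simp only [hform]
        refine integral_mono (integrable_haarUnitary_of_continuous ?_)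
          (integrable_haarUnitary_of_continuous (by fun_prop)) fun U =>
            pow_four_sum_le _ _ _ hlam0 hsum
        exact (continuous_finsetSum _ fun i _ =>
          continuous_const.mul (hw i)).pow 4
    _ = ∑ i, lam i * columnMoment b i i 4 0 := by
        rw [integral_finsetSum _ fun x _ => integrable_haarUnitary_of_continuous (by fun_prop)]
        simp only [integral_const_mul, columnMoment, pow_zero, mul_one]
    _ ≤ ∑ i, lam i * (30 / (d * (d + 1) * ((d + 2) * (d + 4)))) :=
        Finset.sum_le_sum fun i _ =>
          mul_le_mul_of_nonneg_left (columnMoment_four_bound b i) (hlam0 i)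
    _ ≤ _ := by
        rw [← Finset.sum_mul]
        exact mul_le_of_le_one_left (by positivity) hsum

/-! ### Outcome probabilities of a measurement in a random basis -/

/-- The probability of outcome `b` when `ρ` is measured in the basis given by `V`. -/
noncomputable def basisProb {d : ℕ} (ρ : Matrix (Fin d) (Fin d) ℂ) (V : UnitaryMat d)
    (b : Fin d) : ℝ :=
  (basisPOVM V b * ρ).trace.re

theorem trace_basisPOVM_mul {d : ℕ} (ρ : Matrix (Fin d) (Fin d) ℂ) (V : UnitaryMat d)
    (b : Fin d) : (basisPOVM V b * ρ).trace = quadForm ρ (unitaryColumn b V⁻¹) := by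
  have hs := Matrix.single_eq_single_vecMulVec_single (α := ℂ) b b
  have hcol : unitaryColumn b V⁻¹ = (V : Matrix (Fin d) (Fin d) ℂ)ᴴ *ᵥ Pi.single b 1 := by
    ext i
    simp [unitaryColumn]
  rw [quadForm, hcol, Matrix.star_mulVec, Matrix.conjTranspose_conjTranspose, basisPOVM, hs,
    Matrix.mul_vecMulVec, Matrix.vecMulVec_mul, Matrix.vecMulVec_mul,
    Matrix.trace_vecMulVec, dotProduct_comm, ← Matrix.dotProduct_mulVec]
  simp [Pi.star_single, Matrix.dotProduct_mulVec]

theorem quadForm_im {d : ℕ} {ρ : Matrix (Fin d) (Fin d) ℂ} (hρ : ρ.PosSemidef) (v : Fin d → ℂ) :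
    (quadForm ρ v).im = 0 :=
  (Complex.nonneg_iff.mp (quadForm_nonneg hρ v)).2.symm

theorem basisProb_nonneg {d : ℕ} {ρ : Matrix (Fin d) (Fin d) ℂ} (hρ : ρ.PosSemidef)
    (V : UnitaryMat d) (b : Fin d) : 0 ≤ basisProb ρ V b := by
  rw [basisProb, trace_basisPOVM_mul]
  exact (Complex.nonneg_iff.mp (quadForm_nonneg hρ _)).1

theorem continuous_basisProb {d : ℕ} (ρ : Matrix (Fin d) (Fin d) ℂ) (b : Fin d) :
    Continuous fun V : UnitaryMat d => basisProb ρ V b := by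
  simp only [basisProb, trace_basisPOVM_mul]
  exact Complex.continuous_re.comp ((continuous_quadForm_unitaryColumn ρ b).comp continuous_inv)

theorem integral_basisProb_mul {d : ℕ} {ρ σ : Matrix (Fin d) (Fin d) ℂ} (hρ : ρ.PosSemidef)
    (hσ : σ.PosSemidef) (b : Fin d) :
    ∫ V, basisProb ρ V b * basisProb σ V b ∂haarUnitary d =
      (ρ.trace.re * σ.trace.re + (ρ * σ).trace.re) / (d * (d + 1)) := by
  have h := congrArg Complex.re (integral_quadForm_mul ρ σ b)
  have hre : ∀ V : UnitaryMat d, basisProb ρ V b * basisProb σ V b =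
      (quadForm ρ (unitaryColumn b V⁻¹) * quadForm σ (unitaryColumn b V⁻¹)).re := by
    intro V
    rw [basisProb, basisProb, trace_basisPOVM_mul, trace_basisPOVM_mul, Complex.mul_re,
      quadForm_im hρ, quadForm_im hσ, mul_zero, sub_zero]
  have hint : Integrable (fun U : UnitaryMat d => quadForm ρ (unitaryColumn b U) *
      quadForm σ (unitaryColumn b U)) (haarUnitary d) :=
    integrable_haarUnitary_of_continuous ((continuous_quadForm_unitaryColumn ρ b).mul
      (continuous_quadForm_unitaryColumn σ b))
  simp only [hre]
  rw [integral_inv_eq_self (fun U : UnitaryMat d => (quadForm ρ (unitaryColumn b U) *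
      quadForm σ (unitaryColumn b U)).re)]
  have h2 : ((∫ U, quadForm ρ (unitaryColumn b U) * quadForm σ (unitaryColumn b U)
      ∂haarUnitary d).re) = ∫ U, (quadForm ρ (unitaryColumn b U) *
      quadForm σ (unitaryColumn b U)).re ∂haarUnitary d := (integral_re hint).symm
  rw [← h2, h]
  have him : ρ.trace.im = 0 := (Complex.nonneg_iff.mp hρ.trace_nonneg).2.symm
  have hd : ((d : ℂ) * (d + 1)) = ((d * (d + 1) : ℝ) : ℂ) := by push_cast; rfl
  rw [hd, Complex.div_ofReal_re, Complex.add_re, Complex.mul_re, him]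
  simp

theorem integral_basisProb_pow_four_le {d : ℕ} {ρ : Matrix (Fin d) (Fin d) ℂ} (hρ : ρ.PosSemidef)
    (htr : ρ.trace.re ≤ 1) (b : Fin d) :
    ∫ V, basisProb ρ V b ^ 4 ∂haarUnitary d ≤ 30 / (d * (d + 1) * ((d + 2) * (d + 4))) := by
  simp only [basisProb, trace_basisPOVM_mul]
  rw [integral_inv_eq_self (fun U : UnitaryMat d => (quadForm ρ (unitaryColumn b U)).re ^ 4)]
  exact integral_quadForm_pow_four_le hρ htr b

/-! ### Expectations of independent finitely valued random variables -/

section ProductExp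

variable {ι κ α : Type*} [Fintype ι] [DecidableEq ι] [Fintype κ] [DecidableEq κ] [Fintype α]

/-- The expectation of `f` when the coordinate `t` has the law `w t`, independently. -/
def productExp (w : ι → α → ℝ) (f : (ι → α) → ℝ) : ℝ :=
  ∑ o, (∏ t, w t (o t)) * f o

theorem productExp_add (w : ι → α → ℝ) (f g : (ι → α) → ℝ) :
    productExp w (fun o => f o + g o) = productExp w f + productExp w g := by
  simp only [productExp, mul_add, Finset.sum_add_distrib]

theorem productExp_sub (w : ι → α → ℝ) (f g : (ι → α) → ℝ) :
    productExp w (fun o => f o - g o) = productExp w f - productExp w g := by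
  simp only [productExp, mul_sub, Finset.sum_sub_distrib]

theorem productExp_const_mul (w : ι → α → ℝ) (c : ℝ) (f : (ι → α) → ℝ) :
    productExp w (fun o => c * f o) = c * productExp w f := by
  simp only [productExp, Finset.mul_sum]
  exact Finset.sum_congr rfl fun o _ => by ring

theorem productExp_sum {β : Type*} (s : Finset β) (w : ι → α → ℝ) (f : β → (ι → α) → ℝ) :
    productExp w (fun o => ∑ b ∈ s, f b o) = ∑ b ∈ s, productExp w (f b) := by
  simp only [productExp, Finset.mul_sum]
  rw [Finset.sum_comm]

theorem productExp_mono {w : ι → α → ℝ} (hw : ∀ t a, 0 ≤ w t a) {f g : (ι → α) → ℝ}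
    (h : ∀ o, f o ≤ g o) : productExp w f ≤ productExp w g :=
  Finset.sum_le_sum fun o _ =>
    mul_le_mul_of_nonneg_left (h o) (Finset.prod_nonneg fun t _ => hw t _)

/-- Independence in this finite setting is just distributivity of products over sums. The one- and
two-coordinate formulas below follow by taking the other factors to be `1`. -/
theorem productExp_prod (w g : ι → α → ℝ) :
    productExp w (fun o => ∏ t, g t (o t)) = ∏ t, ∑ a, w t a * g t a := by
  simp only [productExp, ← Finset.prod_mul_distrib, Fintype.prod_sum]

theorem productExp_one {w : ι → α → ℝ} (hw : ∀ t, ∑ a, w t a = 1) :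
    productExp w (fun _ => 1) = 1 := by
  have := productExp_prod w fun _ _ => 1
  simpa [hw] using this

theorem productExp_const {w : ι → α → ℝ} (hw : ∀ t, ∑ a, w t a = 1) (c : ℝ) :
    productExp w (fun _ => c) = c := by
  have := productExp_const_mul w c fun _ => 1
  simpa [productExp_one hw] using this

theorem productExp_eval {w : ι → α → ℝ} (hw : ∀ t, ∑ a, w t a = 1) (i : ι) (F : α → ℝ) :
    productExp w (fun o => F (o i)) = ∑ a, w i a * F a := by
  have h := productExp_prod w fun t a => if t = i then F a else 1
  simp only [Finset.prod_ite_eq', Finset.mem_univ, if_true] at h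
  rw [h, Finset.prod_eq_single i (fun t _ ht => by simp [ht, hw]) (by simp)]
  simp

theorem productExp_eval_mul {w : ι → α → ℝ} (hw : ∀ t, ∑ a, w t a = 1) {i j : ι} (hij : i ≠ j)
    (F G : α → ℝ) :
    productExp w (fun o => F (o i) * G (o j)) = (∑ a, w i a * F a) * ∑ a, w j a * G a := by
  have h := productExp_prod w fun t a => (if t = i then F a else 1) * (if t = j then G a else 1)
  simp only [Finset.prod_mul_distrib, Finset.prod_ite_eq', Finset.mem_univ, if_true] at h
  rw [h, Finset.prod_eq_mul i j hij (fun t _ ht => by simp [ht.1, ht.2, hw]) (by simp) (by simp)]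
  simp [hij, hij.symm]

theorem productExp_curry (w : ι × κ → α → ℝ) (f : (ι × κ → α) → ℝ) :
    productExp w f = productExp (fun i (a : κ → α) => ∏ k, w (i, k) (a k))
      (fun o => f fun t => o t.1 t.2) := by
  simp only [productExp]
  refine Fintype.sum_equiv (Equiv.curry ι κ α) _ _ fun o => ?_
  rw [Fintype.prod_prod_type]
  rfl

theorem sum_prod_eq_one {w : ι → α → ℝ} (hw : ∀ t, ∑ a, w t a = 1) :
    ∑ o : ι → α, ∏ t, w t (o t) = 1 := by
  simpa [productExp] using productExp_one hw

theorem productExp_curry_mul {w : ι × κ → α → ℝ} (hw : ∀ t, ∑ a, w t a = 1) {i j : ι}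
    (hij : i ≠ j) (F G : (κ → α) → ℝ) :
    productExp w (fun o => F (fun k => o (i, k)) * G (fun k => o (j, k))) =
      productExp (fun k => w (i, k)) F * productExp (fun k => w (j, k)) G := by
  rw [productExp_curry]
  exact productExp_eval_mul (fun i => sum_prod_eq_one fun k => hw (i, k)) hij F G

/-- Chebyshev's inequality for the mean of independent copies of a random variable. -/
theorem productExp_mean_sub_sq_le {w : α → ℝ} (hw : ∑ a, w a = 1)
    (ζ : α → ℝ) {θ V : ℝ} (hθ : ∑ a, w a * ζ a = θ) (hV : ∑ a, w a * ζ a ^ 2 ≤ V) {M : ℕ}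
    (hM : 0 < M) :
    productExp (fun _ : Fin M => w) (fun o => ((M : ℝ)⁻¹ * ∑ i, ζ (o i) - θ) ^ 2) ≤ V / M := by
  have hM' : (M : ℝ) ≠ 0 := by positivity
  have hsq : ∀ o : Fin M → α, ((M : ℝ)⁻¹ * ∑ i, ζ (o i) - θ) ^ 2 =
      ((M : ℝ) ^ 2)⁻¹ * ∑ i, ∑ j, (ζ (o i) - θ) * (ζ (o j) - θ) := by
    intro o
    rw [← Finset.sum_mul_sum, Finset.sum_sub_distrib, Finset.sum_const, Finset.card_univ,
      Fintype.card_fin, nsmul_eq_mul]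
    field_simp
  have hcenter : ∑ a, w a * (ζ a - θ) = 0 := by
    simp only [mul_sub, Finset.sum_sub_distrib, ← Finset.sum_mul, hw, hθ]
    ring
  have hterm : ∀ i j : Fin M, productExp (fun _ : Fin M => w)
      (fun o => (ζ (o i) - θ) * (ζ (o j) - θ)) ≤ if i = j then V else 0 := by
    intro i j
    split_ifs with hij
    · subst hij
      rw [productExp_eval (fun _ => hw) i fun a => (ζ a - θ) * (ζ a - θ)]
      have : ∑ a, w a * ((ζ a - θ) * (ζ a - θ)) =
          ∑ a, w a * ζ a ^ 2 - 2 * θ * ∑ a, w a * ζ a + θ ^ 2 * ∑ a, w a := by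
        simp only [Finset.mul_sum, ← Finset.sum_sub_distrib, ← Finset.sum_add_distrib]
        exact Finset.sum_congr rfl fun a _ => by ring
      rw [this, hθ, hw]
      nlinarith [sq_nonneg θ]
    · rw [productExp_eval_mul (fun _ => hw) hij (fun a => ζ a - θ) (fun a => ζ a - θ), hcenter,
        zero_mul]
  simp only [hsq, productExp_const_mul, productExp_sum]
  calc _ ≤ ((M : ℝ) ^ 2)⁻¹ * ∑ i : Fin M, ∑ j : Fin M, if i = j then V else 0 := by
        gcongr with i _ j _
        exact hterm i j
    _ = V / M := by
        simp
        field_simp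

/-- The indicator of the good event dominates `1 - (deviation)² / ε²` pointwise; take expectations.
-/
theorem one_sub_le_sum_indicator_mean {w : α → ℝ} (hw0 : ∀ a, 0 ≤ w a) (hw : ∑ a, w a = 1)
    (ζ : α → ℝ) {θ V : ℝ} (hθ : ∑ a, w a * ζ a = θ) (hV : ∑ a, w a * ζ a ^ 2 ≤ V) {M : ℕ}
    (hM : 0 < M) {ε : ℝ} (hε : 0 < ε) :
    1 - V / (M * ε ^ 2) ≤ ∑ o : Fin M → α,
      {o : Fin M → α | |(M : ℝ)⁻¹ * ∑ i, ζ (o i) - θ| < ε}.indicator (fun o => ∏ i, w (o i)) o := by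
  have h1 := productExp_mean_sub_sq_le hw ζ hθ hV hM
  have h2 : productExp (fun _ : Fin M => w)
      (fun o => 1 - ((M : ℝ)⁻¹ * ∑ i, ζ (o i) - θ) ^ 2 / ε ^ 2) ≤ ∑ o : Fin M → α,
      {o : Fin M → α | |(M : ℝ)⁻¹ * ∑ i, ζ (o i) - θ| < ε}.indicator
        (fun o => ∏ i, w (o i)) o := by
    refine Finset.sum_le_sum fun o _ => ?_
    have hp : 0 ≤ ∏ i, w (o i) := Finset.prod_nonneg fun i _ => hw0 _
    by_cases h : |(M : ℝ)⁻¹ * ∑ i, ζ (o i) - θ| < ε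
    · rw [Set.indicator_of_mem (by exact h)]
      refine mul_le_of_le_one_right hp ?_
      have : 0 ≤ ((M : ℝ)⁻¹ * ∑ i, ζ (o i) - θ) ^ 2 / ε ^ 2 := by positivity
      linarith
    · rw [Set.indicator_of_notMem (by exact h)]
      refine mul_nonpos_of_nonneg_of_nonpos hp ?_
      rw [sub_nonpos, one_le_div (by positivity)]
      exact sq_le_sq.mpr (by rw [abs_of_pos hε]; exact not_lt.mp h)
  refine le_trans ?_ h2
  simp only [div_eq_mul_inv _ (ε ^ 2)]
  simp only [mul_comm _ (ε ^ 2)⁻¹]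
  rw [productExp_sub, productExp_one fun _ => hw, productExp_const_mul]
  have : V / (M * ε ^ 2) = (ε ^ 2)⁻¹ * (V / M) := by field_simp
  rw [this]
  gcongr

end ProductExp

/-! ### Averages of independent blocks with random seeds -/

section Blocks

variable {S κ α : Type*} [MeasurableSpace S] [Fintype κ] [Fintype α]

theorem integrable_prod_outcome {ν : Measure S} [IsProbabilityMeasure ν] {P : κ → S → α → ℝ}
    (hPm : ∀ k a, Measurable fun s => P k s a) (hP0 : ∀ k s a, 0 ≤ P k s a)
    (hP1 : ∀ k s, ∑ a, P k s a = 1) (a : κ → α) :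
    Integrable (fun s => ∏ k, P k s (a k)) ν := by
  refine Integrable.of_bound (C := 1)
    (Finset.measurable_prod _ fun k _ => hPm k (a k)).aestronglyMeasurable (.of_forall fun s => ?_)
  rw [Real.norm_of_nonneg (Finset.prod_nonneg fun k _ => hP0 _ _ _)]
  refine Finset.prod_le_one (fun k _ => hP0 _ _ _) fun k _ => ?_
  rw [← hP1 k s]
  exact Finset.single_le_sum (fun a _ => hP0 k s a) (Finset.mem_univ _)

variable [DecidableEq κ]

theorem sum_integral_prod_outcome_mul {ν : Measure S} [IsProbabilityMeasure ν]
    {P : κ → S → α → ℝ} (hPm : ∀ k a, Measurable fun s => P k s a) (hP0 : ∀ k s a, 0 ≤ P k s a)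
    (hP1 : ∀ k s, ∑ a, P k s a = 1) (f : (κ → α) → ℝ) :
    ∑ a : κ → α, (∫ s, ∏ k, P k s (a k) ∂ν) * f a =
      ∫ s, productExp (fun k => P k s) f ∂ν := by
  simp only [productExp]
  rw [integral_finsetSum _ fun a _ => (integrable_prod_outcome hPm hP0 hP1 a).mul_const _]
  simp only [integral_mul_const]

/-- Rounds in one block share a seed and are only conditionally independent. Averaging over the seed
turns a whole block into a single sample with weight `∫ s, ∏ k, P k s (a k)`. Since the seeds of the
blocks are independent, Fubini makes the full law a product of these weights, and the finite
Chebyshev bound applies. -/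
theorem one_sub_le_integral_indicator_mean {ν : Measure S} [IsProbabilityMeasure ν]
    {P : κ → S → α → ℝ} (hPm : ∀ k a, Measurable fun s => P k s a) (hP0 : ∀ k s a, 0 ≤ P k s a)
    (hP1 : ∀ k s, ∑ a, P k s a = 1) (ζ : (κ → α) → ℝ) {θ V : ℝ}
    (hθ : ∫ s, productExp (fun k => P k s) ζ ∂ν = θ)
    (hV : ∫ s, productExp (fun k => P k s) (fun o => ζ o ^ 2) ∂ν ≤ V) {M : ℕ} (hM : 0 < M)
    {ε : ℝ} (hε : 0 < ε) :
    1 - V / (M * ε ^ 2) ≤ ∫ s : Fin M → S, ∑ o : Fin M × κ → α,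
      {o : Fin M × κ → α | |(M : ℝ)⁻¹ * ∑ i, ζ (fun k => o (i, k)) - θ| < ε}.indicator
        (fun o => ∏ t, P t.2 (s t.1) (o t)) o ∂Measure.pi fun _ => ν := by
  have hint : ∀ o : Fin M × κ → α, Integrable (fun s : Fin M → S => ∏ t, P t.2 (s t.1) (o t))
      (Measure.pi fun _ => ν) := fun o =>
    integrable_prod_outcome (P := fun (t : Fin M × κ) (s : Fin M → S) => P t.2 (s t.1))
      (fun t a => (hPm t.2 a).comp (measurable_pi_apply t.1)) (fun t s a => hP0 _ _ _)
      (fun t s => hP1 _ _) o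
  have hprod : ∀ o : Fin M × κ → α, ∫ s : Fin M → S, ∏ t, P t.2 (s t.1) (o t)
      ∂Measure.pi (fun _ => ν) = ∏ i, ∫ s, ∏ k, P k s (o (i, k)) ∂ν := by
    intro o
    simp only [Fintype.prod_prod_type]
    exact integral_fintype_prod_eq_prod (μ := fun _ : Fin M => ν)
      (fun i s => ∏ k, P k s (o (i, k)))
  have hw : ∑ a : κ → α, ∫ s, ∏ k, P k s (a k) ∂ν = 1 := by
    have := sum_integral_prod_outcome_mul (ν := ν) hPm hP0 hP1 fun _ => 1
    simpa [productExp_one, hP1] using this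
  have h := one_sub_le_sum_indicator_mean (w := fun a : κ → α => ∫ s, ∏ k, P k s (a k) ∂ν)
    (fun a => integral_nonneg fun s => Finset.prod_nonneg fun k _ => hP0 _ _ _) hw ζ
    ((sum_integral_prod_outcome_mul hPm hP0 hP1 ζ).trans hθ)
    ((sum_integral_prod_outcome_mul hPm hP0 hP1 fun o => ζ o ^ 2).trans_le hV) hM hε
  refine h.trans_eq ?_
  have hind : ∀ (s : Fin M → S) (o : Fin M × κ → α),
      {o : Fin M × κ → α | |(M : ℝ)⁻¹ * ∑ i, ζ (fun k => o (i, k)) - θ| < ε}.indicator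
        (fun o => ∏ t, P t.2 (s t.1) (o t)) o =
      (∏ t, P t.2 (s t.1) (o t)) *
      {o : Fin M × κ → α | |(M : ℝ)⁻¹ * ∑ i, ζ (fun k => o (i, k)) - θ| < ε}.indicator
        (fun _ => 1) o := by
    intro s o
    by_cases ho : o ∈ {o : Fin M × κ → α | |(M : ℝ)⁻¹ * ∑ i, ζ (fun k => o (i, k)) - θ| < ε}
    · rw [Set.indicator_of_mem ho, Set.indicator_of_mem ho, mul_one]
    · rw [Set.indicator_of_notMem ho, Set.indicator_of_notMem ho, mul_zero]
  simp only [hind]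
  rw [integral_finsetSum _ fun o _ => (hint o).mul_const _]
  simp only [integral_mul_const, hprod]
  refine (Fintype.sum_equiv (Equiv.curry (Fin M) κ α) _ _ fun o => ?_).symm
  by_cases ho : o ∈ {o : Fin M × κ → α | |(M : ℝ)⁻¹ * ∑ i, ζ (fun k => o (i, k)) - θ| < ε}
  · rw [Set.indicator_of_mem ho, Set.indicator_of_mem (by exact ho), mul_one]
    rfl
  · rw [Set.indicator_of_notMem ho, Set.indicator_of_notMem (by exact ho), mul_zero]

end Blocks

/-! ### Conditional moments of the inner-product estimator -/

section Counts

variable {ι α : Type*} [Fintype ι] [DecidableEq ι] [Fintype α] [DecidableEq α] {m : ℕ}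

/-- The number of copies `k` whose outcome is `b`. -/
def outcomeCount (e : Fin m → ι) (b : α) (x : ι → Option α) : ℝ :=
  ∑ k, if x (e k) = some b then 1 else 0

theorem productExp_outcomeCount {w : ι → Option α → ℝ} (hw : ∀ t, ∑ a, w t a = 1)
    (e : Fin m → ι) {p : α → ℝ} (hp : ∀ k b, w (e k) (some b) = p b) (b : α) :
    productExp w (outcomeCount e b) = m * p b := by
  unfold outcomeCount
  rw [productExp_sum]
  simp only [productExp_eval hw (e _) fun a => if a = some b then 1 else 0]
  simp [hp]

/-- The exact value has `m (m - 1)` in place of `m²`; the `m` coincident pairs `k = l` are charged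
an extra `p b * p b' ≥ 0` to simplify the bound. -/
theorem productExp_outcomeCount_mul_le {w : ι → Option α → ℝ} (hw0 : ∀ t a, 0 ≤ w t a)
    (hw : ∀ t, ∑ a, w t a = 1)
    {e : Fin m → ι} (he : Function.Injective e) {p : α → ℝ}
    (hp : ∀ k b, w (e k) (some b) = p b) (b b' : α) :
    productExp w (fun x => outcomeCount e b x * outcomeCount e b' x) ≤
      m ^ 2 * (p b * p b') + if b = b' then m * p b else 0 := by
  simp only [outcomeCount, Finset.sum_mul_sum, productExp_sum]
  have hterm : ∀ k l : Fin m, productExp w (fun x => (if x (e k) = some b then (1 : ℝ) else 0) *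
      if x (e l) = some b' then 1 else 0) ≤
        p b * p b' + if k = l then (if b = b' then p b else 0) else 0 := by
    intro k l
    by_cases hkl : k = l
    · subst hkl
      rw [productExp_eval hw (e k) fun a => (if a = some b then (1 : ℝ) else 0) *
        if a = some b' then 1 else 0]
      have h0 : 0 ≤ p b * p b' := by
        rw [← hp k, ← hp k]; exact mul_nonneg (hw0 _ _) (hw0 _ _)
      by_cases hb : b = b'
      · subst hb
        simp [hp]
        exact mul_self_nonneg _
      · simpa [hb, Ne.symm hb, hp] using h0
    · rw [productExp_eval_mul hw (he.ne hkl) (fun a => if a = some b then (1 : ℝ) else 0)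
        (fun a => if a = some b' then (1 : ℝ) else 0)]
      simp [hp, hkl]
  refine (Finset.sum_le_sum fun k _ => Finset.sum_le_sum fun l _ => hterm k l).trans_eq ?_
  simp [Finset.sum_add_distrib]
  ring

end Counts

/-- Sorting collisions by their common value expresses the estimator through counts on the two
sides, which are independent. Failures drop out because `b` ranges over genuine outcomes only. -/
theorem collisionEstimator_eq {d m : ℕ} {ι : Type*} (e : Fin m → ι) (x y : ι → Option (Fin d)) :
    collisionEstimator (fun k => x (e k)) (fun k => y (e k)) =
      ((m : ℝ) ^ 2)⁻¹ * ∑ b, outcomeCount e b x * outcomeCount e b y := by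
  unfold collisionEstimator outcomeCount
  congr 1
  simp only [Finset.sum_mul_sum]
  rw [Finset.sum_comm' (t' := Finset.univ) (s' := fun _ => Finset.univ) (by simp)]
  conv_rhs => rw [Finset.sum_comm]
  rw [Finset.sum_comm]
  refine Finset.sum_congr rfl fun j _ => ?_
  rw [Finset.sum_comm]
  refine Finset.sum_congr rfl fun k _ => ?_
  rcases Option.eq_none_or_eq_some (x (e j)) with hx | ⟨a, hx⟩
  · simp [hx]
  · by_cases hy : y (e k) = some a
    · simp [hx, hy]
    · have : ∀ b, (if some a = some b then (1 : ℝ) else 0) *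
          (if y (e k) = some b then 1 else 0) = 0 := by
        intro b
        by_cases hb : a = b
        · subst hb; simp [hy]
        · simp [hb]
      simp only [hx, this]
      simp [Ne.symm hy]

theorem collisionEstimator_copy {d N m : ℕ} (l : Fin N) (x y : CopyIndex N m → Option (Fin d)) :
    collisionEstimator (fun k => x (Sum.inl (l, k))) (fun k => y (Sum.inl (l, k))) =
      ((m : ℝ) ^ 2)⁻¹ * ∑ b, outcomeCount (fun k => Sum.inl (l, k)) b x *
        outcomeCount (fun k => Sum.inl (l, k)) b y :=
  collisionEstimator_eq (fun k => Sum.inl (l, k)) x y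

theorem validFraction_mem_Icc {d n : ℕ} (x : Fin n → Option (Fin d)) :
    0 ≤ validFraction x ∧ validFraction x ≤ 1 := by
  have h0 : ∀ j, (0 : ℝ) ≤ if x j ≠ none then 1 else 0 := fun j => by split_ifs <;> norm_num
  have h1 : ∀ j, (if x j ≠ none then 1 else 0 : ℝ) ≤ 1 := fun j => by split_ifs <;> norm_num
  refine ⟨mul_nonneg (by positivity) (Finset.sum_nonneg fun j _ => h0 j), ?_⟩
  unfold validFraction
  have h2 : ∑ j, (if x j ≠ none then 1 else 0 : ℝ) ≤ n := by
    simpa using Finset.sum_le_sum fun j (_ : j ∈ Finset.univ) => h1 j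
  rcases Nat.eq_zero_or_pos n with hn | hn
  · subst hn; simp
  · rw [inv_mul_le_iff₀ (by positivity)]
    simpa using h2

/-- From `(x - t)² ≤ 2 x² + 2 t²` with `t = t₁ t₂ ≤ 1`, and Cauchy–Schwarz over the `N` bases. No
variance reduction from averaging the bases is claimed, so the bound is uniform in `N`. -/
theorem innerProductEstimate_sq_le {d N m : ℕ} (hN : 0 < N) (x y : CopyIndex N m → Option (Fin d)) :
    innerProductEstimate x y ^ 2 ≤ 2 * ((N : ℝ)⁻¹ * ∑ l, ((d : ℝ) + 1) ^ 2 *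
      collisionEstimator (fun k => x (Sum.inl (l, k))) (fun k => y (Sum.inl (l, k))) ^ 2) + 2 := by
  unfold innerProductEstimate
  have h1 := validFraction_mem_Icc fun j => x (Sum.inr j)
  have h2 := validFraction_mem_Icc fun j => y (Sum.inr j)
  generalize validFraction (fun j => x (Sum.inr j)) = t₁ at *
  generalize validFraction (fun j => y (Sum.inr j)) = t₂ at *
  have ht : (t₁ * t₂) ^ 2 ≤ 1 :=
    pow_le_one₀ (mul_nonneg h1.1 h2.1) (mul_le_one₀ h1.2 h2.1 h2.2)
  set G := fun l : Fin N => ((d : ℝ) + 1) *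
    collisionEstimator (fun k => x (Sum.inl (l, k))) (fun k => y (Sum.inl (l, k))) with hG
  have h3 : ((N : ℝ)⁻¹ * ∑ l, G l) ^ 2 ≤ (N : ℝ)⁻¹ * ∑ l, G l ^ 2 := by
    have := sq_sum_le_card_mul_sum_sq (s := Finset.univ) (f := G)
    rw [Finset.card_univ, Fintype.card_fin] at this
    have hN' : (N : ℝ) ≠ 0 := by positivity
    calc _ = ((N : ℝ)⁻¹) ^ 2 * (∑ l, G l) ^ 2 := by ring
      _ ≤ ((N : ℝ)⁻¹) ^ 2 * (N * ∑ l, G l ^ 2) := by gcongr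
      _ = _ := by field_simp
  have h4 : ∀ l, ((d : ℝ) + 1) ^ 2 *
      collisionEstimator (fun k => x (Sum.inl (l, k))) (fun k => y (Sum.inl (l, k))) ^ 2 =
      G l ^ 2 := fun l => by rw [hG]; ring
  simp only [h4]
  nlinarith [sq_nonneg ((N : ℝ)⁻¹ * ∑ l, G l + t₁ * t₂)]

/-- The left side is `(∑ p q)² + ∑ (p² q / m + p q² / m + p q / m²)`. Cauchy–Schwarz handles the
square; for the cubic terms, `p / m ≤ (p² + m⁻²) / 2` and `p q (p² + q²) ≤ p⁴ + q⁴`. Thus no third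
moments or mixed fourth moments of the Haar measure are needed. -/
theorem sum_collision_moments_le {d m : ℕ} (hm : 0 < m) {p q : Fin d → ℝ} (hp : ∀ b, 0 ≤ p b)
    (hq : ∀ b, 0 ≤ q b) :
    ((m : ℝ) ^ 4)⁻¹ * ∑ b, ∑ b', (m ^ 2 * (p b * p b') + if b = b' then m * p b else 0) *
      (m ^ 2 * (q b * q b') + if b = b' then m * q b else 0) ≤
      2 / m ^ 2 * ∑ b, p b * q b + ((d : ℝ) + 1) / 2 * ∑ b, (p b ^ 4 + q b ^ 4) := by
  have hm' : (m : ℝ) ≠ 0 := by positivity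
  have hexp : ((m : ℝ) ^ 4)⁻¹ * ∑ b, ∑ b', (m ^ 2 * (p b * p b') + if b = b' then m * p b else 0) *
      (m ^ 2 * (q b * q b') + if b = b' then m * q b else 0) =
      (∑ b, p b * q b) ^ 2 + ∑ b, (p b ^ 2 * q b / m + p b * q b ^ 2 / m + p b * q b / m ^ 2) := by
    rw [sq (∑ b, p b * q b), Finset.sum_mul_sum, ← Finset.sum_add_distrib, Finset.mul_sum]
    refine Finset.sum_congr rfl fun b _ => ?_
    have hb : ∀ b', (m ^ 2 * (p b * p b') + if b = b' then m * p b else 0) *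
      (m ^ 2 * (q b * q b') + if b = b' then m * q b else 0) =
      (m : ℝ) ^ 4 * (p b * q b * (p b' * q b')) + if b = b' then (m : ℝ) ^ 4 *
        (p b ^ 2 * q b / m + p b * q b ^ 2 / m + p b * q b / m ^ 2) else 0 := by
      intro b'
      split_ifs with h
      · subst h
        field_simp
        ring
      · ring
    simp only [hb, Finset.sum_add_distrib, Finset.sum_ite_eq, Finset.mem_univ, if_true, mul_add,
      Finset.mul_sum]
    field_simp
  rw [hexp]
  have h1 : (∑ b, p b * q b) ^ 2 ≤ d * ∑ b, (p b ^ 4 + q b ^ 4) / 2 := by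
    have := sq_sum_le_card_mul_sum_sq (s := Finset.univ) (f := fun b => p b * q b)
    rw [Finset.card_univ, Fintype.card_fin] at this
    refine this.trans ?_
    gcongr with b _
    nlinarith [sq_nonneg (p b ^ 2 - q b ^ 2)]
  have h2 : ∀ b, p b ^ 2 * q b / m + p b * q b ^ 2 / m + p b * q b / m ^ 2 ≤
      2 / m ^ 2 * (p b * q b) + (p b ^ 4 + q b ^ 4) / 2 := by
    intro b
    have hpq := mul_nonneg (hp b) (hq b)
    have e1 : p b ^ 2 * q b / m = (p b * q b) * (p b * (m : ℝ)⁻¹) := by ring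
    have e2 : p b * q b ^ 2 / m = (p b * q b) * (q b * (m : ℝ)⁻¹) := by ring
    have e3 : p b * q b / m ^ 2 = (p b * q b) * (m : ℝ)⁻¹ ^ 2 := by
      rw [div_eq_mul_inv, inv_pow]
    have e4 : 2 / (m : ℝ) ^ 2 * (p b * q b) = 2 * ((p b * q b) * (m : ℝ)⁻¹ ^ 2) := by
      rw [div_eq_mul_inv, inv_pow]; ring
    rw [e1, e2, e3, e4]
    generalize (m : ℝ)⁻¹ = r
    have f1 : (p b * q b) * (p b * r) ≤ (p b * q b) * ((p b ^ 2 + r ^ 2) / 2) :=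
      mul_le_mul_of_nonneg_left (by nlinarith [sq_nonneg (p b - r)]) hpq
    have f2 : (p b * q b) * (q b * r) ≤ (p b * q b) * ((q b ^ 2 + r ^ 2) / 2) :=
      mul_le_mul_of_nonneg_left (by nlinarith [sq_nonneg (q b - r)]) hpq
    have f3 : p b * q b * (p b ^ 2 + q b ^ 2) ≤ p b ^ 4 + q b ^ 4 := by
      nlinarith [mul_nonneg (sq_nonneg (p b - q b))
        (by nlinarith [sq_nonneg (p b + q b)] : 0 ≤ p b ^ 2 + p b * q b + q b ^ 2)]
    nlinarith
  refine (add_le_add h1 (Finset.sum_le_sum fun b _ => h2 b)).trans_eq ?_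
  rw [Finset.sum_add_distrib, ← Finset.mul_sum, ← Finset.sum_div]
  ring

/-- The law of the outcome of copy `c` of the subnormalized state `ρ` given the random bases. -/
noncomputable def copyProb {d N m : ℕ} [NeZero d] (ρ : Matrix (Fin d) (Fin d) ℂ)
    (V : Fin N → UnitaryMat d) (c : CopyIndex N m) : Option (Fin d) → ℝ
  | none => 1 - ρ.trace.re
  | some b => (copyPOVM V c b * ρ).trace.re

/-- A positive semidefinite matrix of trace at most `1`. -/
def IsSubnormalized {d : ℕ} (ρ : Matrix (Fin d) (Fin d) ℂ) : Prop :=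
  ρ.PosSemidef ∧ ρ.trace.re ≤ 1

theorem IsSubnormalized.trace_nonneg {d : ℕ} {ρ : Matrix (Fin d) (Fin d) ℂ}
    (hρ : IsSubnormalized ρ) : 0 ≤ ρ.trace.re :=
  (Complex.nonneg_iff.mp hρ.1.trace_nonneg).1

section Conditional

variable {d N m : ℕ} [NeZero d] {ρ σ : Matrix (Fin d) (Fin d) ℂ}

theorem copyProb_nonneg (hρ : IsSubnormalized ρ)
    (V : Fin N → UnitaryMat d) (c : CopyIndex N m) (a : Option (Fin d)) :
    0 ≤ copyProb ρ V c a := by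
  rcases a with _ | b
  · exact sub_nonneg.mpr hρ.2
  · rcases c with ⟨i, k⟩ | j
    · exact basisProb_nonneg hρ.1 (V i) b
    · simp only [copyProb, copyPOVM, trivialPOVM]
      split_ifs
      · simpa using hρ.trace_nonneg
      · simp

theorem sum_copyProb (ρ : Matrix (Fin d) (Fin d) ℂ) (V : Fin N → UnitaryMat d)
    (c : CopyIndex N m) : ∑ a, copyProb ρ V c a = 1 := by
  rw [Fintype.sum_option]
  simp only [copyProb]
  rw [← Complex.re_sum, ← Matrix.trace_sum, ← Finset.sum_mul, (copyPOVM_isPOVM V c).2, one_mul]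
  ring

theorem productExp_validFraction (hNm : 0 < N * m) (ρ : Matrix (Fin d) (Fin d) ℂ)
    (V : Fin N → UnitaryMat d) :
    productExp (copyProb (m := m) ρ V) (fun x => validFraction fun j => x (Sum.inr j)) =
      ρ.trace.re := by
  unfold validFraction
  rw [productExp_const_mul, productExp_sum]
  simp only [productExp_eval (sum_copyProb ρ V) (Sum.inr _) fun a => if a ≠ none then (1 : ℝ) else 0]
  rw [Finset.sum_congr rfl (g := fun _ => ρ.trace.re) fun j _ => ?_]
  · rw [Finset.sum_const, Finset.card_univ, Fintype.card_fin, nsmul_eq_mul, ← mul_assoc,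
      inv_mul_cancel₀ (by positivity), one_mul]
  · have := sum_copyProb ρ V (Sum.inr j : CopyIndex N m)
    rw [Fintype.sum_option] at this ⊢
    simp [copyProb] at this ⊢
    linarith

theorem copyProb_inl (ρ : Matrix (Fin d) (Fin d) ℂ) (V : Fin N → UnitaryMat d) (l : Fin N)
    (k : Fin m) (b : Fin d) :
    copyProb ρ V (Sum.inl (l, k)) (some b) = basisProb ρ (V l) b :=
  rfl

theorem productExp_outcomeCount_copy (ρ : Matrix (Fin d) (Fin d) ℂ) (V : Fin N → UnitaryMat d)
    (l : Fin N) (b : Fin d) :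
    productExp (copyProb (m := m) ρ V) (outcomeCount (fun k => Sum.inl (l, k)) b) =
      m * basisProb ρ (V l) b :=
  productExp_outcomeCount (sum_copyProb ρ V) (fun k => Sum.inl (l, k))
    (copyProb_inl ρ V l) b

variable {s : Type*}

/-- Joint law of the outcomes on the copies of several states. -/
noncomputable def jointCopyProb (τ : s → Matrix (Fin d) (Fin d) ℂ) (V : Fin N → UnitaryMat d)
    (t : s × CopyIndex N m) : Option (Fin d) → ℝ :=
  copyProb (τ t.1) V t.2

theorem jointCopyProb_nonneg {τ : s → Matrix (Fin d) (Fin d) ℂ}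
    (hτ : ∀ i, IsSubnormalized (τ i)) (V : Fin N → UnitaryMat d) (t : s × CopyIndex N m)
    (a : Option (Fin d)) : 0 ≤ jointCopyProb τ V t a :=
  copyProb_nonneg (hτ t.1) V t.2 a

theorem sum_jointCopyProb (τ : s → Matrix (Fin d) (Fin d) ℂ) (V : Fin N → UnitaryMat d)
    (t : s × CopyIndex N m) : ∑ a, jointCopyProb τ V t a = 1 :=
  sum_copyProb (τ t.1) V t.2

variable [Fintype s] [DecidableEq s]

/-- Only the labels must differ: `τ i` and `τ j` may be the same state, as they are for the purity
index. The label type is left free so that pairs and the four inputs used for the unitarity are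
treated together. -/
theorem productExp_jointCopyProb_mul (τ : s → Matrix (Fin d) (Fin d) ℂ)
    (V : Fin N → UnitaryMat d) {i j : s} (hij : i ≠ j)
    (F G : (CopyIndex N m → Option (Fin d)) → ℝ) :
    productExp (jointCopyProb τ V) (fun o => F (fun c => o (i, c)) * G (fun c => o (j, c))) =
      productExp (copyProb (τ i) V) F * productExp (copyProb (τ j) V) G :=
  productExp_curry_mul (fun t => sum_copyProb (τ t.1) V t.2) hij F G

theorem productExp_collisionEstimator (hm : 0 < m) (τ : s → Matrix (Fin d) (Fin d) ℂ)
    (V : Fin N → UnitaryMat d) {i j : s} (hij : i ≠ j) (l : Fin N) :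
    productExp (jointCopyProb (m := m) τ V) (fun o => collisionEstimator
      (fun k => o (i, Sum.inl (l, k))) (fun k => o (j, Sum.inl (l, k)))) =
      ∑ b, basisProb (τ i) (V l) b * basisProb (τ j) (V l) b := by
  simp only [fun o : s × CopyIndex N m → Option (Fin d) => collisionEstimator_copy l
    (fun c => o (i, c)) (fun c => o (j, c))]
  rw [productExp_const_mul, productExp_sum, Finset.mul_sum]
  refine Finset.sum_congr rfl fun b _ => ?_
  rw [productExp_jointCopyProb_mul τ V hij, productExp_outcomeCount_copy,
    productExp_outcomeCount_copy]
  have : (m : ℝ) ≠ 0 := by positivity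
  field_simp

theorem productExp_innerProductEstimate (hN : 0 < N) (hm : 0 < m)
    (τ : s → Matrix (Fin d) (Fin d) ℂ) (V : Fin N → UnitaryMat d) {i j : s} (hij : i ≠ j) :
    productExp (jointCopyProb (m := m) τ V)
      (fun o => innerProductEstimate (fun c => o (i, c)) (fun c => o (j, c))) =
      (N : ℝ)⁻¹ * ∑ l, ((d : ℝ) + 1) * ∑ b, basisProb (τ i) (V l) b * basisProb (τ j) (V l) b -
        (τ i).trace.re * (τ j).trace.re := by
  unfold innerProductEstimate
  rw [productExp_sub, productExp_const_mul, productExp_sum]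
  simp only [productExp_const_mul, productExp_collisionEstimator hm τ V hij]
  congr 1
  refine (productExp_jointCopyProb_mul τ V hij (fun x => validFraction fun j => x (Sum.inr j))
    (fun x => validFraction fun j => x (Sum.inr j))).trans ?_
  rw [productExp_validFraction (by positivity), productExp_validFraction (by positivity)]

theorem productExp_collisionEstimator_sq_le (hm : 0 < m) {τ : s → Matrix (Fin d) (Fin d) ℂ}
    (hτ : ∀ i, IsSubnormalized (τ i)) (V : Fin N → UnitaryMat d) {i j : s} (hij : i ≠ j)
    (l : Fin N) :
    productExp (jointCopyProb (m := m) τ V) (fun o => collisionEstimator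
      (fun k => o (i, Sum.inl (l, k))) (fun k => o (j, Sum.inl (l, k))) ^ 2) ≤
      2 / m ^ 2 * ∑ b, basisProb (τ i) (V l) b * basisProb (τ j) (V l) b + ((d : ℝ) + 1) / 2 *
        ∑ b, (basisProb (τ i) (V l) b ^ 4 + basisProb (τ j) (V l) b ^ 4) := by
  refine le_trans ?_ (sum_collision_moments_le hm (fun b => basisProb_nonneg (hτ i).1 (V l) b)
    (fun b => basisProb_nonneg (hτ j).1 (V l) b))
  have hsq : ∀ o : s × CopyIndex N m → Option (Fin d), collisionEstimator
      (fun k => o (i, Sum.inl (l, k))) (fun k => o (j, Sum.inl (l, k))) ^ 2 =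
      ((m : ℝ) ^ 4)⁻¹ * ∑ b, ∑ b',
        (outcomeCount (fun k => Sum.inl (l, k)) b (fun c => o (i, c)) *
          outcomeCount (fun k => Sum.inl (l, k)) b' (fun c => o (i, c))) *
        (outcomeCount (fun k => Sum.inl (l, k)) b (fun c => o (j, c)) *
          outcomeCount (fun k => Sum.inl (l, k)) b' (fun c => o (j, c))) := by
    intro o
    rw [collisionEstimator_copy l (fun c => o (i, c)) (fun c => o (j, c)), mul_pow, sq (∑ b, _),
      Finset.sum_mul_sum, ← inv_pow, ← inv_pow, ← pow_mul]
    congr 1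
    exact Finset.sum_congr rfl fun b _ => Finset.sum_congr rfl fun b' _ => by ring
  simp only [hsq]
  rw [productExp_const_mul, productExp_sum]
  simp only [productExp_sum]
  have hinj : Function.Injective fun k : Fin m => (Sum.inl (l, k) : CopyIndex N m) :=
    fun k k' h => (Prod.mk.inj (Sum.inl.inj h)).2
  have hnn : ∀ (i : s) (b b' : Fin d), 0 ≤ productExp (copyProb (m := m) (τ i) V)
      (fun x => outcomeCount (fun k => Sum.inl (l, k)) b x *
        outcomeCount (fun k => Sum.inl (l, k)) b' x) := fun i b b' =>
    Finset.sum_nonneg fun o _ => mul_nonneg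
      (Finset.prod_nonneg fun t _ => copyProb_nonneg (hτ i) V _ _)
      (mul_nonneg (Finset.sum_nonneg fun k _ => by split_ifs <;> norm_num)
        (Finset.sum_nonneg fun k _ => by split_ifs <;> norm_num))
  have hle : ∀ (i : s) (b b' : Fin d), productExp (copyProb (m := m) (τ i) V)
      (fun x => outcomeCount (fun k => Sum.inl (l, k)) b x *
        outcomeCount (fun k => Sum.inl (l, k)) b' x) ≤
        m ^ 2 * (basisProb (τ i) (V l) b * basisProb (τ i) (V l) b') +
          if b = b' then m * basisProb (τ i) (V l) b else 0 := fun i b b' =>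
    productExp_outcomeCount_mul_le (fun t a => copyProb_nonneg (hτ i) V t a)
      (sum_copyProb (τ i) V) hinj (copyProb_inl (τ i) V l) b b'
  gcongr with b _ b' _
  refine (productExp_jointCopyProb_mul τ V hij
    (fun x => outcomeCount (fun k => Sum.inl (l, k)) b x *
        outcomeCount (fun k => Sum.inl (l, k)) b' x)
    (fun x => outcomeCount (fun k => Sum.inl (l, k)) b x *
        outcomeCount (fun k => Sum.inl (l, k)) b' x)).trans_le ?_
  -- Independence of the two sides makes the mixed moment of the counts a product, one bounded
  -- factor per state.
  exact mul_le_mul (hle i b b') (hle j b b') (hnn j b b') ((hnn i b b').trans (hle i b b'))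

theorem productExp_innerProductEstimate_sq_le (hN : 0 < N) (hm : 0 < m)
    {τ : s → Matrix (Fin d) (Fin d) ℂ} (hτ : ∀ i, IsSubnormalized (τ i))
    (V : Fin N → UnitaryMat d) {i j : s} (hij : i ≠ j) :
    productExp (jointCopyProb (m := m) τ V)
      (fun o => innerProductEstimate (fun c => o (i, c)) (fun c => o (j, c)) ^ 2) ≤
      2 * ((N : ℝ)⁻¹ * ∑ l, ((d : ℝ) + 1) ^ 2 *
        (2 / m ^ 2 * ∑ b, basisProb (τ i) (V l) b * basisProb (τ j) (V l) b + ((d : ℝ) + 1) / 2 *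
          ∑ b, (basisProb (τ i) (V l) b ^ 4 + basisProb (τ j) (V l) b ^ 4))) + 2 := by
  have h := productExp_mono (w := jointCopyProb (m := m) τ V)
    (jointCopyProb_nonneg hτ V) fun o =>
    innerProductEstimate_sq_le hN (fun c => o (i, c)) (fun c => o (j, c))
  refine h.trans ?_
  rw [productExp_add, productExp_const (sum_jointCopyProb τ V),
    productExp_const_mul, productExp_const_mul, productExp_sum]
  simp only [productExp_const_mul]
  gcongr with l _
  exact productExp_collisionEstimator_sq_le hm hτ V hij l

end Conditional

/-! ### Traces of products of positive semidefinite matrices -/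

theorem sum_basisProb {d : ℕ} (ρ : Matrix (Fin d) (Fin d) ℂ) (V : UnitaryMat d) :
    ∑ b, basisProb ρ V b = ρ.trace.re := by
  simp only [basisProb]
  rw [← Complex.re_sum, ← Matrix.trace_sum, ← Finset.sum_mul, (basisPOVM_isPOVM V).2, one_mul]

/-- The spectral theorem, phrased with `basisPOVM` so that `tr (A B)` becomes an eigenvalue-weighted
sum of the outcome weights `basisProb B V b`. -/
theorem exists_eq_sum_basisPOVM {d : ℕ} {A : Matrix (Fin d) (Fin d) ℂ} (hA : A.PosSemidef) :
    ∃ (V : UnitaryMat d) (lam : Fin d → ℝ), (∀ b, 0 ≤ lam b) ∧ ∑ b, lam b = A.trace.re ∧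
      A = ∑ b, (lam b : ℂ) • basisPOVM V b := by
  refine ⟨hA.1.eigenvectorUnitary⁻¹, hA.1.eigenvalues, hA.eigenvalues_nonneg, ?_, ?_⟩
  · conv_rhs => rw [hA.1.trace_eq_sum_eigenvalues]
    simp
  · have h1 : A = (hA.1.eigenvectorUnitary : Matrix (Fin d) (Fin d) ℂ) *
        Matrix.diagonal (fun i => (hA.1.eigenvalues i : ℂ)) *
        (hA.1.eigenvectorUnitary : Matrix (Fin d) (Fin d) ℂ)ᴴ := hA.1.spectral_theorem
    have h2 : Matrix.diagonal (fun i => (hA.1.eigenvalues i : ℂ)) =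
        ∑ b, (hA.1.eigenvalues b : ℂ) • Matrix.single b b (1 : ℂ) := by
      rw [← Matrix.sum_single_eq_diagonal]
      simp [Matrix.smul_single]
    conv_lhs => rw [h1, h2]
    rw [Finset.mul_sum, Finset.sum_mul]
    refine Finset.sum_congr rfl fun b _ => ?_
    rw [Matrix.mul_smul, Matrix.smul_mul, basisPOVM]
    congr 3
    rw [← Matrix.star_eq_conjTranspose]
    simp

/-- In an eigenbasis of `A`, the trace is a nonnegative combination of outcome weights of `B`, each
between `0` and `tr B`. -/
theorem trace_mul_re_mem_Icc {d : ℕ} {A B : Matrix (Fin d) (Fin d) ℂ} (hA : A.PosSemidef)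
    (hB : B.PosSemidef) : 0 ≤ (A * B).trace.re ∧ (A * B).trace.re ≤ A.trace.re * B.trace.re := by
  obtain ⟨V, lam, h0, hsum, hV⟩ := exists_eq_sum_basisPOVM hA
  have h : (A * B).trace.re = ∑ b, lam b * basisProb B V b := by
    conv_lhs => rw [hV]
    rw [Finset.sum_mul, Matrix.trace_sum, Complex.re_sum]
    refine Finset.sum_congr rfl fun b _ => ?_
    rw [Matrix.smul_mul, Matrix.trace_smul, smul_eq_mul, Complex.re_ofReal_mul, basisProb]
  rw [h, ← hsum, Finset.sum_mul]
  refine ⟨Finset.sum_nonneg fun b _ => mul_nonneg (h0 b) (basisProb_nonneg hB V b),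
    Finset.sum_le_sum fun b _ => mul_le_mul_of_nonneg_left ?_ (h0 b)⟩
  rw [← sum_basisProb B V]
  exact Finset.single_le_sum (fun b _ => basisProb_nonneg hB V b) (Finset.mem_univ b)

/-! ### Moments of the inner-product estimator with random bases -/

theorem integral_pi_haarUnitary {d N : ℕ} (l : Fin N) {f : UnitaryMat d → ℝ} (hf : Continuous f) :
    ∫ V : Fin N → UnitaryMat d, f (V l) ∂Measure.pi (fun _ => haarUnitary d) =
      ∫ V, f V ∂haarUnitary d :=
  integral_comp_eval (μ := fun _ : Fin N => haarUnitary d) (i := l)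
    (integrable_haarUnitary_of_continuous hf).aestronglyMeasurable

theorem integrable_pi_haarUnitary {d N : ℕ} (l : Fin N) {f : UnitaryMat d → ℝ}
    (hf : Continuous f) : Integrable (fun V : Fin N → UnitaryMat d => f (V l))
      (Measure.pi fun _ => haarUnitary d) :=
  integrable_comp_eval (μ := fun _ : Fin N => haarUnitary d) (i := l)
    (integrable_haarUnitary_of_continuous hf)

section RandomBases

variable {d N m : ℕ} [NeZero d] {s : Type*} [Fintype s] [DecidableEq s]

theorem integral_productExp_innerProductEstimate (hN : 0 < N) (hm : 0 < m)
    {τ : s → Matrix (Fin d) (Fin d) ℂ} (hτ : ∀ i, IsSubnormalized (τ i)) {i j : s} (hij : i ≠ j) :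
    ∫ V : Fin N → UnitaryMat d, productExp (jointCopyProb (m := m) τ V)
      (fun o => innerProductEstimate (fun c => o (i, c)) (fun c => o (j, c)))
      ∂Measure.pi (fun _ => haarUnitary d) = (τ i * τ j).trace.re := by
  have hd : (d : ℝ) ≠ 0 := Nat.cast_ne_zero.mpr (NeZero.ne d)
  have hd1 : (d : ℝ) + 1 ≠ 0 := by positivity
  have hN' : (N : ℝ) ≠ 0 := by positivity
  have hc := fun k b => continuous_basisProb (τ k) b
  have hcont : Continuous fun V : UnitaryMat d => ((d : ℝ) + 1) *
      ∑ b, basisProb (τ i) V b * basisProb (τ j) V b := by fun_prop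
  simp only [productExp_innerProductEstimate hN hm τ _ hij]
  rw [integral_sub ((integrable_finsetSum _ fun l _ =>
      integrable_pi_haarUnitary l hcont).const_mul _) (integrable_const _),
    integral_const_mul, integral_finsetSum _ fun l _ => integrable_pi_haarUnitary l hcont]
  simp only [integral_pi_haarUnitary _ hcont]
  rw [integral_const_mul, integral_finsetSum _ fun b _ =>
    integrable_haarUnitary_of_continuous (by fun_prop)]
  simp only [integral_basisProb_mul (hτ i).1 (hτ j).1]
  simp
  field_simp
  ring

/-- The random basis gives `E ∑ p q ≤ 2 / (d + 1)` and `E ∑ (p⁴ + q⁴) = O(d⁻³)`; the factors `(d +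
1)²` and `(d + 1)³` leave `4 (d + 1) / m²` and a constant. Integrability is a hypothesis because the
caller obtains it, for almost every input unitary, from the joint law. -/
theorem integral_productExp_innerProductEstimate_sq_le (hN : 0 < N) (hm : 0 < m)
    {τ : s → Matrix (Fin d) (Fin d) ℂ} (hτ : ∀ i, IsSubnormalized (τ i)) {i j : s} (hij : i ≠ j)
    (hint : Integrable (fun V : Fin N → UnitaryMat d => productExp (jointCopyProb (m := m) τ V)
      (fun o => innerProductEstimate (fun c => o (i, c)) (fun c => o (j, c)) ^ 2))
      (Measure.pi fun _ => haarUnitary d)) :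
    ∫ V : Fin N → UnitaryMat d, productExp (jointCopyProb (m := m) τ V)
      (fun o => innerProductEstimate (fun c => o (i, c)) (fun c => o (j, c)) ^ 2)
      ∂Measure.pi (fun _ => haarUnitary d) ≤ 8 * ((d : ℝ) + 1) / m ^ 2 + 62 := by
  have hd : 0 < (d : ℝ) := Nat.cast_pos.mpr (NeZero.pos d)
  have hN' : (N : ℝ) ≠ 0 := by positivity
  have hc := fun k b => continuous_basisProb (τ k) b
  have hcont : Continuous fun V : UnitaryMat d => ((d : ℝ) + 1) ^ 2 *
      (2 / m ^ 2 * ∑ b, basisProb (τ i) V b * basisProb (τ j) V b + ((d : ℝ) + 1) / 2 *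
          ∑ b, (basisProb (τ i) V b ^ 4 + basisProb (τ j) V b ^ 4)) := by fun_prop
  refine (integral_mono hint ?_ fun V =>
    productExp_innerProductEstimate_sq_le hN hm hτ V hij).trans ?_
  · exact ((((integrable_finsetSum _ fun l _ =>
      integrable_pi_haarUnitary l hcont).const_mul _).const_mul _).add (integrable_const _))
  rw [integral_add (((integrable_finsetSum _ fun l _ =>
      integrable_pi_haarUnitary l hcont).const_mul _).const_mul _) (integrable_const _),
    integral_const_mul, integral_const_mul,
    integral_finsetSum _ fun l _ => integrable_pi_haarUnitary l hcont]
  simp only [integral_pi_haarUnitary _ hcont]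
  have h1 : ∫ V, ∑ b, basisProb (τ i) V b * basisProb (τ j) V b ∂haarUnitary d ≤ 2 / (d + 1) := by
    rw [integral_finsetSum _ fun b _ => integrable_haarUnitary_of_continuous (by fun_prop)]
    simp only [integral_basisProb_mul (hτ i).1 (hτ j).1]
    have ht : (τ i).trace.re * (τ j).trace.re ≤ 1 :=
      mul_le_one₀ (hτ i).2 (hτ j).trace_nonneg (hτ j).2
    have ht2 : (τ i * τ j).trace.re ≤ 1 := (trace_mul_re_mem_Icc (hτ i).1 (hτ j).1).2.trans ht
    rw [Finset.sum_const, Finset.card_univ, Fintype.card_fin, nsmul_eq_mul]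
    calc _ ≤ (d : ℝ) * ((1 + 1) / (d * (d + 1))) := by gcongr
      _ = _ := by field_simp; norm_num
  have h2 : ∫ V, ∑ b, (basisProb (τ i) V b ^ 4 + basisProb (τ j) V b ^ 4) ∂haarUnitary d ≤
      60 / ((d + 1) * ((d + 2) * (d + 4))) := by
    rw [integral_finsetSum _ fun b _ => integrable_haarUnitary_of_continuous (by fun_prop)]
    calc _ ≤ ∑ b : Fin d, (30 / (d * (d + 1) * ((d + 2) * (d + 4))) +
        30 / (d * (d + 1) * ((d + 2) * (d + 4))) : ℝ) := by
          refine Finset.sum_le_sum fun b _ => ?_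
          rw [integral_add (integrable_haarUnitary_of_continuous (by fun_prop))
            (integrable_haarUnitary_of_continuous (by fun_prop))]
          exact add_le_add (integral_basisProb_pow_four_le (hτ i).1 (hτ i).2 b)
            (integral_basisProb_pow_four_le (hτ j).1 (hτ j).2 b)
      _ = _ := by
          rw [Finset.sum_const, Finset.card_univ, Fintype.card_fin, nsmul_eq_mul]
          field_simp
          norm_num
  rw [integral_const_mul, integral_add (integrable_haarUnitary_of_continuous (by fun_prop))
    (integrable_haarUnitary_of_continuous (by fun_prop)), integral_const_mul, integral_const_mul]
  have h3 : ((d : ℝ) + 1) ^ 2 * (2 / m ^ 2 *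
      ∫ V, ∑ b, basisProb (τ i) V b * basisProb (τ j) V b ∂haarUnitary d + ((d : ℝ) + 1) / 2 *
      ∫ V, ∑ b, (basisProb (τ i) V b ^ 4 + basisProb (τ j) V b ^ 4) ∂haarUnitary d) ≤
      4 * (d + 1) / m ^ 2 + 30 := by
    calc _ ≤ ((d : ℝ) + 1) ^ 2 * (2 / m ^ 2 * (2 / (d + 1)) + ((d : ℝ) + 1) / 2 *
        (60 / ((d + 1) * ((d + 2) * (d + 4))))) := by gcongr
      _ = 4 * (d + 1) / m ^ 2 + 30 * (((d : ℝ) + 1) ^ 2 / ((d + 2) * (d + 4))) := by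
        field_simp
        ring
      _ ≤ 4 * (d + 1) / m ^ 2 + 30 * 1 := by
        gcongr
        rw [div_le_one (by positivity)]
        nlinarith
      _ = _ := by ring
  rw [Finset.sum_const, Finset.card_univ, Fintype.card_fin, nsmul_eq_mul, ← mul_assoc (N : ℝ)⁻¹,
    inv_mul_cancel₀ hN', one_mul]
  simp only [integral_const, probReal_univ, smul_eq_mul, one_mul]
  calc _ ≤ 2 * (4 * ((d : ℝ) + 1) / m ^ 2 + 30) + 2 := by gcongr
    _ = _ := by ring

end RandomBases

/-! ### Channels -/

/-- By cyclicity the lost trace is `tr ((1 - ∑ Kᴴ K) ρ)`, a product of two positive semidefinite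
matrices. -/
theorem QuantumChannel.isSubnormalized {d : ℕ} (E : QuantumChannel d)
    {ρ : Matrix (Fin d) (Fin d) ℂ} (hρ : IsDensityMatrix ρ) : IsSubnormalized (E.toLin ρ) := by
  obtain ⟨r, K, hK, hE⟩ := E.exists_kraus
  rw [hE]
  refine ⟨Matrix.posSemidef_sum _ fun i _ => hρ.1.mul_mul_conjTranspose_same _, ?_⟩
  have h1 : (∑ i, K i * ρ * (K i)ᴴ).trace = ((∑ i, (K i)ᴴ * K i) * ρ).trace := by
    rw [Matrix.trace_sum, Finset.sum_mul, Matrix.trace_sum]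
    exact Finset.sum_congr rfl fun i _ => by rw [Matrix.trace_mul_comm, mul_assoc]
  have h2 := (trace_mul_re_mem_Icc hK hρ.1).1
  rw [sub_mul, one_mul, Matrix.trace_sub, ← h1, hρ.2] at h2
  simpa using h2

theorem QuantumChannel.measurable_toLin {d : ℕ} (E : QuantumChannel d) {S : Type*}
    [MeasurableSpace S] {τ : S → Matrix (Fin d) (Fin d) ℂ}
    (hτ : ∀ i j, Measurable fun s => τ s i j) (i j : Fin d) :
    Measurable fun s => E.toLin (τ s) i j := by
  obtain ⟨r, K, -, hE⟩ := E.exists_kraus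
  simp only [hE, Matrix.sum_apply, Matrix.mul_apply]
  fun_prop

section Block

variable {d N m : ℕ} [NeZero d] {s : Type*}

/-- The joint law of the outcomes of a block of rounds in which the states `τ i U` are prepared,
sent through the channel and measured. -/
noncomputable def blockProb (E : QuantumChannel d) (τ : s → UnitaryMat d → Matrix (Fin d) (Fin d) ℂ)
    (t : s × CopyIndex N m) (p : UnitaryMat d × (Fin N → UnitaryMat d)) : Option (Fin d) → ℝ :=
  jointCopyProb (fun i => E.toLin (τ i p.1)) p.2 t

theorem measurable_blockProb (E : QuantumChannel d)
    {τ : s → UnitaryMat d → Matrix (Fin d) (Fin d) ℂ}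
    (hτm : ∀ i k l, Measurable fun U => τ i U k l) (t : s × CopyIndex N m) (a : Option (Fin d)) :
    Measurable fun p => blockProb E τ t p a := by
  have h1 : ∀ k l, Measurable fun p : UnitaryMat d × (Fin N → UnitaryMat d) =>
      E.toLin (τ t.1 p.1) k l := fun k l => (E.measurable_toLin (hτm t.1) k l).comp measurable_fst
  have h2 : ∀ b k l, Measurable fun p : UnitaryMat d × (Fin N → UnitaryMat d) =>
      copyPOVM p.2 t.2 b k l := fun b k l => (measurable_copyPOVM t.2 b k l).comp measurable_snd
  rcases a with _ | b
  · simp only [blockProb, jointCopyProb, copyProb, Matrix.trace, Matrix.diag_apply]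
    fun_prop
  · simp only [blockProb, jointCopyProb, copyProb, Matrix.trace, Matrix.diag_apply,
      Matrix.mul_apply]
    fun_prop

variable {E : QuantumChannel d} {τ : s → UnitaryMat d → Matrix (Fin d) (Fin d) ℂ}

theorem blockProb_nonneg (hτ : ∀ i U, IsDensityMatrix (τ i U)) (t : s × CopyIndex N m)
    (p : UnitaryMat d × (Fin N → UnitaryMat d)) (a : Option (Fin d)) : 0 ≤ blockProb E τ t p a :=
  jointCopyProb_nonneg (fun i => E.isSubnormalized (hτ i p.1)) p.2 t a

theorem sum_blockProb (t : s × CopyIndex N m) (p : UnitaryMat d × (Fin N → UnitaryMat d)) :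
    ∑ a, blockProb E τ t p a = 1 :=
  sum_jointCopyProb _ p.2 t

variable [Fintype s] [DecidableEq s]

theorem integrable_productExp_blockProb (hτ : ∀ i U, IsDensityMatrix (τ i U))
    (hτm : ∀ i k l, Measurable fun U => τ i U k l)
    (f : (s × CopyIndex N m → Option (Fin d)) → ℝ) :
    Integrable (fun p => productExp (fun t => blockProb E τ t p) f)
      ((haarUnitary d).prod (Measure.pi fun _ => haarUnitary d)) :=
  integrable_finsetSum _ fun o _ => (integrable_prod_outcome (measurable_blockProb E hτm)
    (blockProb_nonneg hτ) sum_blockProb o).mul_const _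

theorem integral_productExp_blockProb (hτ : ∀ i U, IsDensityMatrix (τ i U))
    (hτm : ∀ i k l, Measurable fun U => τ i U k l) (hN : 0 < N) (hm : 0 < m) {i j : s}
    (hij : i ≠ j) :
    ∫ p, productExp (fun t : s × CopyIndex N m => blockProb E τ t p)
        (fun o => innerProductEstimate (fun c => o (i, c)) (fun c => o (j, c)))
        ∂((haarUnitary d).prod (Measure.pi fun _ => haarUnitary d)) =
      ∫ U, (E.toLin (τ i U) * E.toLin (τ j U)).trace.re ∂haarUnitary d := by
  rw [integral_prod _ (integrable_productExp_blockProb hτ hτm _)]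
  congr 1
  ext U
  exact integral_productExp_innerProductEstimate hN hm
    (fun i => E.isSubnormalized (hτ i U)) hij

theorem integral_productExp_blockProb_sq_le (hτ : ∀ i U, IsDensityMatrix (τ i U))
    (hτm : ∀ i k l, Measurable fun U => τ i U k l) (hN : 0 < N) {c : ℝ} (hc : 0 < c)
    (hm : c * Real.sqrt d ≤ m) {i j : s} (hij : i ≠ j) :
    ∫ p, productExp (fun t : s × CopyIndex N m => blockProb E τ t p)
        (fun o => innerProductEstimate (fun c => o (i, c)) (fun c => o (j, c)) ^ 2)
        ∂((haarUnitary d).prod (Measure.pi fun _ => haarUnitary d)) ≤ 16 / c ^ 2 + 62 := by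
  have hd : 1 ≤ (d : ℝ) := Nat.one_le_cast.mpr (NeZero.pos d)
  have hm1 : 0 < (m : ℝ) := lt_of_lt_of_le (by positivity) hm
  have hm0 : 0 < m := Nat.cast_pos.mp hm1
  -- This is where `m` must be of order `√d`: `m² ≥ c² d` and `d + 1 ≤ 2 d`.
  have hbound : 8 * ((d : ℝ) + 1) / m ^ 2 + 62 ≤ 16 / c ^ 2 + 62 := by
    have h1 : c ^ 2 * d ≤ (m : ℝ) ^ 2 := by
      calc c ^ 2 * (d : ℝ) = (c * Real.sqrt d) ^ 2 := by
            rw [mul_pow, Real.sq_sqrt (by positivity)]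
        _ ≤ _ := by gcongr
    have h2 : 8 * ((d : ℝ) + 1) / m ^ 2 ≤ 16 / c ^ 2 := by
      rw [div_le_div_iff₀ (by positivity) (by positivity)]
      nlinarith [sq_nonneg c]
    linarith
  have hint := integrable_productExp_blockProb (N := N) (m := m) (E := E) hτ hτm
    (fun o => innerProductEstimate (fun c => o (i, c)) (fun c => o (j, c)) ^ 2)
  rw [integral_prod _ hint]
  refine (integral_mono_ae hint.integral_prod_left (integrable_const (16 / c ^ 2 + 62))
    (hint.prod_right_ae.mono fun U hU => ?_)).trans_eq (by simp)
  exact (integral_productExp_innerProductEstimate_sq_le hN hm0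
    (fun i => E.isSubnormalized (hτ i U)) hij hU).trans hbound

end Block

/-! ### The estimator for a pair of input states -/

theorem pairEstimator_outcomeProb {d : ℕ} [NeZero d] (a b : Fin d) (M N m : ℕ)
    (E : QuantumChannel d) :
    (pairEstimator d a b M N m).outcomeProb E = fun t p =>
      blockProb E (fun i U => rotatedState U (if i then b else a)) t.2 (p t.1) := by
  funext t p o
  cases o <;> rfl

theorem pairEstimator_probEstimateMem {d : ℕ} [NeZero d] (a b : Fin d) {M N m : ℕ} (hM : 0 < M)
    (hN : 0 < N) {c : ℝ} (hc : 0 < c) (hm : c * Real.sqrt d ≤ m) {ε : ℝ} (hε : 0 < ε)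
    (E : QuantumChannel d) :
    1 - (16 / c ^ 2 + 62) / (M * ε ^ 2) ≤ (pairEstimator d a b M N m).probEstimateMem E
      {z | |z - ∫ U, (E.toLin (rotatedState U a) * E.toLin (rotatedState U b)).trace.re
        ∂haarUnitary d| < ε} := by
  have hd : 0 < (d : ℝ) := Nat.cast_pos.mpr (NeZero.pos d)
  have hm0 : 0 < m := Nat.cast_pos.mp (lt_of_lt_of_le (by positivity) hm)
  have hτ : ∀ (i : Bool) (U : UnitaryMat d), IsDensityMatrix (rotatedState U (if i then b else a)) :=
    fun i U => rotatedState_isDensityMatrix _ _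
  have hτm : ∀ (i : Bool) (k l : Fin d), Measurable fun U : UnitaryMat d =>
      rotatedState U (if i then b else a) k l := fun i k l => measurable_rotatedState _ k l
  refine (one_sub_le_integral_indicator_mean
    (measurable_blockProb (N := N) (m := m) E hτm) (fun t p => blockProb_nonneg hτ t p)
    sum_blockProb (fun o => innerProductEstimate (fun c => o (false, c)) (fun c => o (true, c)))
    (integral_productExp_blockProb hτ hτm hN hm0 Bool.false_ne_true)
    (integral_productExp_blockProb_sq_le hτ hτm hN hc hm Bool.false_ne_true) hM hε).trans_eq ?_
  rw [IncoherentAlgorithm.probEstimateMem, pairEstimator_outcomeProb]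
  rfl

theorem calls_pairEstimator {d : ℕ} [NeZero d] (a b : Fin d) (M N m : ℕ) :
    (pairEstimator d a b M N m).calls = 4 * (M * N * m) := by
  have : (pairEstimator d a b M N m).calls = Fintype.card (Fin M × Bool × CopyIndex N m) := rfl
  rw [this]
  simp
  ring

/-- The lower bound on `M` is three times the second-moment bound over `ε²`, so the Chebyshev
failure probability is at most `1/3`. -/
theorem two_thirds_le_pairEstimator {d : ℕ} [NeZero d] (a b : Fin d) {M N m : ℕ}
    {c : ℝ} (hc : 0 < c) {ε : ℝ} (hε : 0 < ε)
    (hM : 3 * (16 / c ^ 2 + 62) * (ε ^ 2)⁻¹ ≤ M) (hN : 1 ≤ N) (hm : c * Real.sqrt d ≤ m)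
    (E : QuantumChannel d) :
    2 / 3 ≤ (pairEstimator d a b M N m).probEstimateMem E
      {z | |z - ∫ U, (E.toLin (rotatedState U a) * E.toLin (rotatedState U b)).trace.re
        ∂haarUnitary d| < ε} := by
  have hM1 : 0 < (M : ℝ) := lt_of_lt_of_le (by positivity) hM
  have hM0 : 0 < M := Nat.cast_pos.mp hM1
  refine le_trans ?_ (pairEstimator_probEstimateMem a b hM0 hN hc hm hε E)
  have : (16 / c ^ 2 + 62) / (M * ε ^ 2) ≤ 1 / 3 := by
    rw [← div_eq_mul_inv, div_le_iff₀ (by positivity)] at hM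
    rw [div_le_iff₀ (by positivity)]
    linarith
  linarith

theorem calls_pairEstimator_le {d : ℕ} [NeZero d] (a b : Fin d) {M N m : ℕ} {K ε : ℝ}
    (hM : (M : ℝ) ≤ K * (ε ^ 2)⁻¹) (hN1 : 1 ≤ N) (hN : (N : ℝ) ≤ K)
    (hm : (m : ℝ) ≤ K * Real.sqrt d) :
    ((pairEstimator d a b M N m).calls : ℝ) ≤ 4 * K ^ 3 * (Real.sqrt d * (ε ^ 2)⁻¹) := by
  have hK : 0 ≤ K := (Nat.cast_nonneg N).trans hN
  rw [calls_pairEstimator]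
  push_cast
  calc 4 * ((M : ℝ) * N * m) ≤ 4 * (K * (ε ^ 2)⁻¹ * K * (K * Real.sqrt d)) := by gcongr
    _ = _ := by ring

/-! ### Unitarity -/

theorem ketBra_maxEntangled {d : ℕ} (j l : Fin d) :
    (Matrix.of fun a b => ketBra (maxEntangled d) (a, j) (b, l)) =
      ((d : ℂ)⁻¹) • Matrix.single j l 1 := by
  ext a b
  have h : (((Real.sqrt d)⁻¹ : ℝ) : ℂ) * (((Real.sqrt d)⁻¹ : ℝ) : ℂ) = (d : ℂ)⁻¹ := by
    rw [← Complex.ofReal_mul, ← mul_inv, Real.mul_self_sqrt (by positivity)]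
    simp
  simp only [Matrix.of_apply, ketBra, Matrix.vecMulVec_apply, Pi.star_apply, maxEntangled,
    Matrix.smul_apply, Matrix.single_apply, smul_eq_mul]
  by_cases ha : a = j
  · by_cases hb : b = l
    · subst ha hb
      simpa using h
    · simp [hb, Ne.symm hb]
  · simp [ha, Ne.symm ha]

theorem jamiolkowski_apply {d : ℕ} (E : QuantumChannel d) (x y : Fin d × Fin d) :
    jamiolkowski E x y = (d : ℂ)⁻¹ * E.toLin (Matrix.single x.2 y.2 1) x.1 y.1 := by
  rw [jamiolkowski, applyFirst, Matrix.of_apply, ketBra_maxEntangled, map_smul, Matrix.smul_apply,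
    smul_eq_mul]

/-- The swap correlator `∑ i j, tr(E(|i⟩⟨j|) E(|j⟩⟨i|))`. -/
noncomputable def swapCorrelator {d : ℕ} (E : QuantumChannel d) : ℂ :=
  ∑ i, ∑ j, (E.toLin (Matrix.single i j 1) * E.toLin (Matrix.single j i 1)).trace

theorem trace_jamiolkowski_sq {d : ℕ} (E : QuantumChannel d) :
    (jamiolkowski E * jamiolkowski E).trace = ((d : ℂ) ^ 2)⁻¹ * swapCorrelator E := by
  simp only [Matrix.trace, Matrix.diag_apply, Matrix.mul_apply, jamiolkowski_apply, swapCorrelator,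
    Fintype.sum_prod_type, Finset.mul_sum]
  rw [Finset.sum_comm]
  refine Finset.sum_congr rfl fun i _ => ?_
  rw [Finset.sum_congr rfl fun a _ => Finset.sum_comm, Finset.sum_comm]
  refine Finset.sum_congr rfl fun j _ => Finset.sum_congr rfl fun a _ =>
    Finset.sum_congr rfl fun b _ => ?_
  rw [← inv_pow]
  ring

theorem rotatedState_eq_sum {d : ℕ} (U : UnitaryMat d) (a : Fin d) :
    rotatedState U a = ∑ x : Fin d × Fin d,
      (unitaryColumn a U x.1 * star (unitaryColumn a U x.2)) • Matrix.single x.1 x.2 1 := by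
  ext i j
  have h : (U : Matrix (Fin d) (Fin d) ℂ) *ᵥ Pi.single a 1 = unitaryColumn a U := by
    ext k
    simp [unitaryColumn]
  rw [rotatedState, h, ketBra, Matrix.vecMulVec_apply, Matrix.sum_apply,
    Finset.sum_eq_single (i, j)]
  · simp
  · intro x _ hx
    rw [Matrix.smul_apply, Matrix.single_apply, if_neg fun h => hx (Prod.ext h.1 h.2), smul_zero]
  · simp

/-- The two index pairings of the second Haar moment give `tr E(1)²` and the swap correlator. The
latter is `d²` times the trace of the squared Jamiołkowski state, which links purity to unitarity.
-/
theorem integral_trace_channel_sq {d : ℕ} (E : QuantumChannel d) (a : Fin d) :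
    ∫ U, (E.toLin (rotatedState U a) * E.toLin (rotatedState U a)).trace ∂haarUnitary d =
      ((E.toLin 1 * E.toLin 1).trace + swapCorrelator E) / ((d : ℂ) * (d + 1)) := by
  set S : Fin d × Fin d → Matrix (Fin d) (Fin d) ℂ := fun x => E.toLin (Matrix.single x.1 x.2 1)
    with hS
  have h := integral_bilinear_column a (fun x y => (S x * S y).trace) Prod.fst Prod.snd Prod.fst
    Prod.snd
  have h1 : ∀ U, (E.toLin (rotatedState U a) * E.toLin (rotatedState U a)).trace =
      ∑ x : Fin d × Fin d, ∑ y : Fin d × Fin d, (S x * S y).trace *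
        (unitaryColumn a U x.1 * star (unitaryColumn a U x.2) *
          (unitaryColumn a U y.1 * star (unitaryColumn a U y.2))) := by
    intro U
    simp only [rotatedState_eq_sum, map_sum, map_smul, Finset.sum_mul_sum, Matrix.trace_sum,
      smul_mul_smul_comm, Matrix.trace_smul, smul_eq_mul]
    exact Finset.sum_congr rfl fun x _ => Finset.sum_congr rfl fun y _ => mul_comm _ _
  have h2 : E.toLin 1 = ∑ i, S (i, i) := by
    rw [← map_sum]
    congr 1
    rw [Matrix.sum_single_eq_diagonal, Matrix.diagonal_one]
  simp only [h1]
  rw [h]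
  simp only [mul_div_assoc', ← Finset.sum_div]
  congr 1
  simp only [mul_add, Finset.sum_add_distrib]
  congr 1
  · rw [h2, Finset.sum_mul_sum, Matrix.trace_sum]
    simp only [Matrix.trace_sum, Fintype.sum_prod_type, ite_and, mul_ite, mul_one, mul_zero,
      Finset.sum_ite_irrel, Finset.sum_ite_eq, Finset.sum_const_zero, Finset.mem_univ, if_true]
  · simp only [swapCorrelator, Fintype.sum_prod_type, ite_and, mul_ite, mul_one, mul_zero,
      Finset.sum_ite_eq, Finset.sum_ite_eq', Finset.mem_univ, if_true, hS]

/-- The maximally mixed state. -/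
noncomputable def maxMixed (d : ℕ) : Matrix (Fin d) (Fin d) ℂ :=
  (d : ℂ)⁻¹ • 1

theorem maxMixed_isDensityMatrix (d : ℕ) [NeZero d] : IsDensityMatrix (maxMixed d) := by
  have hd : (d : ℂ) ≠ 0 := Nat.cast_ne_zero.mpr (NeZero.ne d)
  refine ⟨Matrix.PosSemidef.one.smul (by positivity), ?_⟩
  rw [maxMixed, Matrix.trace_smul, Matrix.trace_one, Fintype.card_fin, smul_eq_mul,
    inv_mul_cancel₀ hd]

theorem unitarity_eq {d : ℕ} [NeZero d] (E : QuantumChannel d) :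
    unitarity E = (1 + (d : ℝ)⁻¹) *
      ∫ U, (E.toLin (rotatedState U 0) * E.toLin (rotatedState U 0)).trace.re ∂haarUnitary d -
      (E.toLin (maxMixed d) * E.toLin (maxMixed d)).trace.re := by
  have hd : (d : ℂ) ≠ 0 := Nat.cast_ne_zero.mpr (NeZero.ne d)
  have hd1 : (d : ℂ) + 1 ≠ 0 := Nat.cast_add_one_ne_zero d
  have hcont : Continuous fun U : UnitaryMat d =>
      (E.toLin (rotatedState U 0) * E.toLin (rotatedState U 0)).trace := by
    have := fun i => continuous_unitaryColumn (0 : Fin d) i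
    simp only [rotatedState_eq_sum, map_sum, map_smul, Finset.sum_mul_sum, Matrix.trace_sum,
      smul_mul_smul_comm, Matrix.trace_smul]
    fun_prop
  have hre : ∫ U, (E.toLin (rotatedState U 0) * E.toLin (rotatedState U 0)).trace.re
      ∂haarUnitary d = (∫ U, (E.toLin (rotatedState U 0) * E.toLin (rotatedState U 0)).trace
      ∂haarUnitary d).re := integral_re (integrable_haarUnitary_of_continuous hcont)
  have hmix : (E.toLin (maxMixed d) * E.toLin (maxMixed d)).trace =
      ((d : ℂ) ^ 2)⁻¹ * (E.toLin 1 * E.toLin 1).trace := by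
    rw [maxMixed, map_smul, smul_mul_smul_comm, Matrix.trace_smul, smul_eq_mul, sq, mul_inv]
  have hC : (1 + (d : ℂ)⁻¹) = ((1 + (d : ℝ)⁻¹ : ℝ) : ℂ) := by push_cast; rfl
  rw [hre, ← Complex.re_ofReal_mul, ← hC, ← Complex.sub_re, unitarity, trace_jamiolkowski_sq,
    hmix, integral_trace_channel_sq]
  congr 1
  field_simp
  ring

/-- The input states of the unitarity estimator: two copies of a Haar random pure state and two
copies of the maximally mixed state. -/
noncomputable def unitarityInput {d : ℕ} [NeZero d] (i : Bool × Bool) (U : UnitaryMat d) :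
    Matrix (Fin d) (Fin d) ℂ :=
  if i.1 then maxMixed d else rotatedState U 0

theorem unitarityInput_isDensityMatrix {d : ℕ} [NeZero d] (i : Bool × Bool) (U : UnitaryMat d) :
    IsDensityMatrix (unitarityInput i U) := by
  unfold unitarityInput
  split_ifs
  exacts [maxMixed_isDensityMatrix d, rotatedState_isDensityMatrix U 0]

theorem measurable_unitarityInput {d : ℕ} [NeZero d] (i : Bool × Bool) (k l : Fin d) :
    Measurable fun U : UnitaryMat d => unitarityInput i U k l := by
  unfold unitarityInput
  split_ifs
  exacts [measurable_const, measurable_rotatedState 0 k l]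

/-- The estimate of the unitarity from one block of outcomes. -/
noncomputable def unitarityBlockEstimate {d m : ℕ}
    (o : (Bool × Bool) × CopyIndex 1 m → Option (Fin d)) : ℝ :=
  (1 + (d : ℝ)⁻¹) * innerProductEstimate (fun c => o ((false, false), c))
      (fun c => o ((false, true), c)) -
    innerProductEstimate (fun c => o ((true, false), c)) (fun c => o ((true, true), c))

/-- The estimation algorithm for the unitarity. -/
noncomputable def unitarityEstimator (d : ℕ) [NeZero d] (M m : ℕ) : IncoherentAlgorithm d where
  Seed := Fin M → UnitaryMat d × (Fin 1 → UnitaryMat d)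
  seedLaw := Measure.pi fun _ => (haarUnitary d).prod (Measure.pi fun _ => haarUnitary d)
  Round := Fin M × (Bool × Bool) × CopyIndex 1 m
  Outcome := Fin d
  state := fun t s => unitarityInput t.2.1 (s t.1).1
  povm := fun t s => copyPOVM (s t.1).2 t.2.2
  estimate := fun _ o => (M : ℝ)⁻¹ * ∑ i : Fin M, unitarityBlockEstimate fun k => o (i, k)
  state_isDensityMatrix := fun _ _ => unitarityInput_isDensityMatrix _ _
  povm_isPOVM := fun _ _ => copyPOVM_isPOVM _ _
  measurable_state := fun t i j =>
    (measurable_unitarityInput _ i j).comp (measurable_fst.comp (measurable_pi_apply t.1))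
  measurable_povm := fun t x i j =>
    (measurable_copyPOVM _ x i j).comp (measurable_snd.comp (measurable_pi_apply t.1))
  measurable_estimate := fun _ => measurable_const

theorem unitarityEstimator_outcomeProb {d : ℕ} [NeZero d] (M m : ℕ) (E : QuantumChannel d) :
    (unitarityEstimator d M m).outcomeProb E = fun t p =>
      blockProb E unitarityInput t.2 (p t.1) := by
  funext t p o
  cases o <;> rfl

theorem calls_unitarityEstimator {d : ℕ} [NeZero d] (M m : ℕ) :
    (unitarityEstimator d M m).calls = 8 * (M * m) := by
  have : (unitarityEstimator d M m).calls =
      Fintype.card (Fin M × (Bool × Bool) × CopyIndex 1 m) := rfl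
  rw [this]
  simp
  ring

theorem integral_unitarityBlockEstimate {d : ℕ} [NeZero d] {m : ℕ} (hm : 0 < m)
    (E : QuantumChannel d) :
    ∫ p, productExp (fun t : (Bool × Bool) × CopyIndex 1 m => blockProb E unitarityInput t p)
      unitarityBlockEstimate ∂((haarUnitary d).prod (Measure.pi fun _ => haarUnitary d)) =
      unitarity E := by
  unfold unitarityBlockEstimate
  simp only [productExp_sub, productExp_const_mul]
  have hint := integrable_productExp_blockProb (E := E) (N := 1) (m := m)
    (unitarityInput_isDensityMatrix (d := d)) measurable_unitarityInput
  rw [integral_sub ((hint _).const_mul _) (hint _), integral_const_mul,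
    integral_productExp_blockProb unitarityInput_isDensityMatrix measurable_unitarityInput
      one_pos hm (by simp),
    integral_productExp_blockProb unitarityInput_isDensityMatrix measurable_unitarityInput
      one_pos hm (by simp), unitarity_eq]
  simp [unitarityInput]

theorem integral_unitarityBlockEstimate_sq_le {d : ℕ} [NeZero d] {m : ℕ}
    (hm : Real.sqrt d ≤ m) (E : QuantumChannel d) :
    ∫ p, productExp (fun t : (Bool × Bool) × CopyIndex 1 m => blockProb E unitarityInput t p)
      (fun o => unitarityBlockEstimate o ^ 2)
      ∂((haarUnitary d).prod (Measure.pi fun _ => haarUnitary d)) ≤ 780 := by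
  have hd : 1 ≤ (d : ℝ) := Nat.one_le_cast.mpr (NeZero.pos d)
  have hint := integrable_productExp_blockProb (E := E) (N := 1) (m := m)
    (unitarityInput_isDensityMatrix (d := d)) measurable_unitarityInput
  have hsq : ∀ o : (Bool × Bool) × CopyIndex 1 m → Option (Fin d), unitarityBlockEstimate o ^ 2 ≤
      8 * innerProductEstimate (fun c => o ((false, false), c))
        (fun c => o ((false, true), c)) ^ 2 + 2 * innerProductEstimate
          (fun c => o ((true, false), c)) (fun c => o ((true, true), c)) ^ 2 := by
    intro o
    unfold unitarityBlockEstimate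
    generalize innerProductEstimate (fun c => o ((false, false), c))
        (fun c => o ((false, true), c)) = x
    generalize innerProductEstimate (fun c => o ((true, false), c))
        (fun c => o ((true, true), c)) = y
    have hinv : (d : ℝ)⁻¹ ≤ 1 := inv_le_one_of_one_le₀ hd
    have hinv0 : 0 ≤ (d : ℝ)⁻¹ := by positivity
    -- Together with `(x - y)² ≤ 2 x² + 2 y²` this explains the coefficients `8` and `2`; at `c = 1`
    -- each second moment is at most `78`, and `780 = (8 + 2) * 78`.
    have h4 : (1 + (d : ℝ)⁻¹) ^ 2 ≤ 4 := by nlinarith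
    have := mul_le_mul_of_nonneg_right h4 (sq_nonneg x)
    nlinarith [sq_nonneg ((1 + (d : ℝ)⁻¹) * x + y)]
  have hbound := fun (i j : Bool × Bool) (hij : i ≠ j) => integral_productExp_blockProb_sq_le
    (E := E) (N := 1) (m := m) unitarityInput_isDensityMatrix measurable_unitarityInput one_pos
    one_pos (by simpa using hm) hij
  calc _ ≤ ∫ p, productExp
        (fun t : (Bool × Bool) × CopyIndex 1 m => blockProb E unitarityInput t p)
        (fun o => 8 * innerProductEstimate (fun c => o ((false, false), c))
          (fun c => o ((false, true), c)) ^ 2 + 2 * innerProductEstimate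
            (fun c => o ((true, false), c)) (fun c => o ((true, true), c)) ^ 2)
        ∂((haarUnitary d).prod (Measure.pi fun _ => haarUnitary d)) :=
        integral_mono (hint _) (hint _) fun p => productExp_mono
          (fun t a => blockProb_nonneg unitarityInput_isDensityMatrix t p a) hsq
    _ ≤ 8 * (16 / 1 ^ 2 + 62) + 2 * (16 / 1 ^ 2 + 62) := by
        simp only [productExp_add, productExp_const_mul]
        rw [integral_add ((hint _).const_mul _) ((hint _).const_mul _), integral_const_mul,
          integral_const_mul]
        gcongr
        · exact hbound _ _ (by simp)
        · exact hbound _ _ (by simp)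
    _ = 780 := by norm_num

/-- A crude bound suffices: it only serves to answer `0` without any call when `ε > 2`. -/
theorem abs_unitarity_le_two {d : ℕ} [NeZero d] (E : QuantumChannel d) : |unitarity E| ≤ 2 := by
  have hd : 1 ≤ (d : ℝ) := Nat.one_le_cast.mpr (NeZero.pos d)
  have h01 : ∀ {ρ : Matrix (Fin d) (Fin d) ℂ}, IsDensityMatrix ρ →
      0 ≤ (E.toLin ρ * E.toLin ρ).trace.re ∧ (E.toLin ρ * E.toLin ρ).trace.re ≤ 1 := by
    intro ρ hρ
    have h := E.isSubnormalized hρ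
    have h2 := trace_mul_re_mem_Icc h.1 h.1
    exact ⟨h2.1, h2.2.trans (mul_le_one₀ h.2 h.trace_nonneg h.2)⟩
  have h1 := h01 (maxMixed_isDensityMatrix d)
  have h2 : 0 ≤ ∫ U, (E.toLin (rotatedState U 0) * E.toLin (rotatedState U 0)).trace.re
      ∂haarUnitary d := integral_nonneg fun U => (h01 (rotatedState_isDensityMatrix U 0)).1
  have h3 : ∫ U, (E.toLin (rotatedState U 0) * E.toLin (rotatedState U 0)).trace.re
      ∂haarUnitary d ≤ 1 := by
    have := norm_integral_le_of_norm_le_const (μ := haarUnitary d) (C := 1)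
      (f := fun U => (E.toLin (rotatedState U 0) * E.toLin (rotatedState U 0)).trace.re)
      (.of_forall fun U => by
        have := h01 (rotatedState_isDensityMatrix U 0)
        rw [Real.norm_of_nonneg this.1]
        exact this.2)
    rw [Real.norm_of_nonneg h2] at this
    simpa using this
  have hinv : (d : ℝ)⁻¹ ≤ 1 := inv_le_one_of_one_le₀ hd
  have hinv0 : 0 ≤ (d : ℝ)⁻¹ := by positivity
  rw [unitarity_eq, abs_le]
  constructor <;> nlinarith

theorem unitarityEstimator_probEstimateMem {d : ℕ} [NeZero d] {M m : ℕ} (hM : 0 < M)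
    (hm : Real.sqrt d ≤ m) {ε : ℝ} (hε : 0 < ε) (E : QuantumChannel d) :
    1 - 780 / (M * ε ^ 2) ≤
      (unitarityEstimator d M m).probEstimateMem E {z | |z - unitarity E| < ε} := by
  have hd : 0 < (d : ℝ) := Nat.cast_pos.mpr (NeZero.pos d)
  have hm0 : 0 < m := Nat.cast_pos.mp (lt_of_lt_of_le (Real.sqrt_pos.mpr hd) hm)
  refine (one_sub_le_integral_indicator_mean
    (measurable_blockProb (N := 1) (m := m) E measurable_unitarityInput)
    (fun t p => blockProb_nonneg unitarityInput_isDensityMatrix t p)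
    sum_blockProb unitarityBlockEstimate (integral_unitarityBlockEstimate hm0 E)
    (integral_unitarityBlockEstimate_sq_le hm E) hM hε).trans_eq ?_
  rw [IncoherentAlgorithm.probEstimateMem, unitarityEstimator_outcomeProb]
  rfl

/-- Without any call the estimate is `0`. -/
theorem unitarityEstimator_zero_probEstimateMem {d : ℕ} [NeZero d] (m : ℕ) {ε : ℝ} (hε : 2 < ε)
    (E : QuantumChannel d) :
    (unitarityEstimator d 0 m).probEstimateMem E {z | |z - unitarity E| < ε} = 1 := by
  have hz : ∀ s o, (unitarityEstimator d 0 m).estimate s o ∈ {z | |z - unitarity E| < ε} := by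
    intro s o
    have : (unitarityEstimator d 0 m).estimate s o = 0 := by simp [unitarityEstimator]
    rw [this, Set.mem_ofPred_eq, zero_sub, abs_neg]
    exact (abs_unitarity_le_two E).trans_lt hε
  have hE : IsEmpty (unitarityEstimator d 0 m).Round :=
    inferInstanceAs (IsEmpty (Fin 0 × (Bool × Bool) × CopyIndex 1 m))
  simp [IncoherentAlgorithm.probEstimateMem, hz]

theorem exists_unitarityEstimator {d : ℕ} [NeZero d] {ε : ℝ} (hε : 0 < ε) :
    ∃ M m : ℕ, ((unitarityEstimator d M m).calls : ℝ) ≤ 40000 * (Real.sqrt d * (ε ^ 2)⁻¹) ∧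
      ∀ E : QuantumChannel d, 2 / 3 ≤
        (unitarityEstimator d M m).probEstimateMem E {z | |z - unitarity E| < ε} := by
  have hd : 1 ≤ (d : ℝ) := Nat.one_le_cast.mpr (NeZero.pos d)
  -- For large `ε` the permitted number of calls drops below one, so no round may be made. For `ε ≤
  -- 2`, `1 ≤ 4 / ε²` absorbs the rounding of `M` into its main term, and `2340 = 3 * 780`.
  rcases lt_or_ge 2 ε with h2 | h2
  · refine ⟨0, 0, ?_, fun E => ?_⟩
    · rw [calls_unitarityEstimator]
      simp
      positivity
    · rw [unitarityEstimator_zero_probEstimateMem 0 h2]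
      norm_num
  · have he : 0 < ε ^ 2 := by positivity
    have hsqrt : 1 ≤ Real.sqrt d := Real.one_le_sqrt.mpr hd
    have hM := Nat.le_ceil (2340 * (ε ^ 2)⁻¹)
    have hM0 : 0 < ⌈2340 * (ε ^ 2)⁻¹⌉₊ := Nat.ceil_pos.mpr (by positivity)
    refine ⟨⌈2340 * (ε ^ 2)⁻¹⌉₊, ⌈Real.sqrt d⌉₊, ?_, fun E => ?_⟩
    · rw [calls_unitarityEstimator]
      push_cast
      have h1 : (⌈2340 * (ε ^ 2)⁻¹⌉₊ : ℝ) ≤ 2344 * (ε ^ 2)⁻¹ := by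
        have h3 := (Nat.ceil_lt_add_one (by positivity : 0 ≤ 2340 * (ε ^ 2)⁻¹)).le
        have h4 : 1 ≤ 4 * (ε ^ 2)⁻¹ := by
          rw [← div_eq_mul_inv, one_le_div he]
          nlinarith
        linarith
      have h5 : (⌈Real.sqrt d⌉₊ : ℝ) ≤ 2 * Real.sqrt d := by
        have := (Nat.ceil_lt_add_one (Real.sqrt_nonneg (d : ℝ))).le
        linarith
      calc 8 * ((⌈2340 * (ε ^ 2)⁻¹⌉₊ : ℝ) * ⌈Real.sqrt d⌉₊)
          ≤ 8 * (2344 * (ε ^ 2)⁻¹ * (2 * Real.sqrt d)) := by gcongr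
        _ = 37504 * (Real.sqrt d * (ε ^ 2)⁻¹) := by ring
        _ ≤ _ := by gcongr; norm_num
    · refine le_trans ?_ (unitarityEstimator_probEstimateMem hM0 (Nat.le_ceil _) hε E)
      have : 780 / (⌈2340 * (ε ^ 2)⁻¹⌉₊ * ε ^ 2) ≤ 1 / 3 := by
        rw [← div_eq_mul_inv, div_le_iff₀ he] at hM
        rw [← div_eq_mul_inv, div_le_iff₀ (by positivity)]
        linarith
      linarith

/-! ### Assembly of the three claims -/

theorem mainTheorem3 :
    -- orthogonality-preservation index: `M = Θ(ε⁻²)`, `N = Θ(1)`, `m = Θ(√d)`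
    (∀ c : ℝ, 0 < c → ∃ c' : ℝ, 0 < c' ∧ ∀ K : ℝ, ∃ C : ℝ,
      ∀ (d : ℕ) [NeZero d], 2 ≤ d → ∀ ε : ℝ, 0 < ε → ∀ M N m : ℕ,
        c' * (ε ^ 2)⁻¹ ≤ M → (M : ℝ) ≤ K * (ε ^ 2)⁻¹ →
        1 ≤ N → (N : ℝ) ≤ K →
        c * Real.sqrt d ≤ m → (m : ℝ) ≤ K * Real.sqrt d →
          ((orthogonalityEstimator d M N m).calls : ℝ) ≤ C * (Real.sqrt d * (ε ^ 2)⁻¹) ∧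
          ∀ E : QuantumChannel d,
            2 / 3 ≤ (orthogonalityEstimator d M N m).probEstimateMem E
              {z | |z - orthogonalityIndex E| < ε}) ∧
    -- purity-preservation index, with the same parameters
    (∀ c : ℝ, 0 < c → ∃ c' : ℝ, 0 < c' ∧ ∀ K : ℝ, ∃ C : ℝ,
      ∀ (d : ℕ) [NeZero d], ∀ ε : ℝ, 0 < ε → ∀ M N m : ℕ,
        c' * (ε ^ 2)⁻¹ ≤ M → (M : ℝ) ≤ K * (ε ^ 2)⁻¹ →
        1 ≤ N → (N : ℝ) ≤ K →
        c * Real.sqrt d ≤ m → (m : ℝ) ≤ K * Real.sqrt d →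
          ((purityEstimator d M N m).calls : ℝ) ≤ C * (Real.sqrt d * (ε ^ 2)⁻¹) ∧
          ∀ E : QuantumChannel d,
            2 / 3 ≤ (purityEstimator d M N m).probEstimateMem E
              {z | |z - purityIndex E| < ε}) ∧
    -- unitarity
    (∃ C : ℝ, ∀ (d : ℕ) [NeZero d], ∀ ε : ℝ, 0 < ε →
      ∃ A : IncoherentAlgorithm d,
        (A.calls : ℝ) ≤ C * (Real.sqrt d * (ε ^ 2)⁻¹) ∧
        ∀ E : QuantumChannel d,
          2 / 3 ≤ A.probEstimateMem E {z | |z - unitarity E| < ε}) := by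
  -- `c'` is three times the second-moment bound. `4 * K ^ 3` bounds the `4 M N m` calls: two
  -- states, each with `N m` copies for the random bases and `N m` for the trivial measurement.
  refine ⟨fun c hc => ⟨3 * (16 / c ^ 2 + 62), by positivity, fun K => ⟨4 * K ^ 3, ?_⟩⟩,
    fun c hc => ⟨3 * (16 / c ^ 2 + 62), by positivity, fun K => ⟨4 * K ^ 3, ?_⟩⟩, 40000, ?_⟩
  · intro d _ _ ε hε M N m hM hMK hN hNK hm hmK
    refine ⟨calls_pairEstimator_le 0 1 hMK hN hNK hmK, fun E => ?_⟩
    have h := two_thirds_le_pairEstimator 0 1 hc hε hM hN hm E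
    -- The index multiplies the outputs for `U|1⟩` and `U|0⟩` in the opposite order; the trace is
    -- cyclic.
    simp only [Matrix.trace_mul_comm (E.toLin (rotatedState _ 0))] at h
    exact h
  · intro d _ ε hε M N m hM hMK hN hNK hm hmK
    exact ⟨calls_pairEstimator_le 0 0 hMK hN hNK hmK,
      two_thirds_le_pairEstimator 0 0 hc hε hM hN hm⟩
  · intro d _ ε hε
    obtain ⟨M, m, hcalls, hprob⟩ := exists_unitarityEstimator (d := d) hε
    exact ⟨unitarityEstimator d M m, hcalls, hprob⟩
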